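/- **Setting.** Let $d\ge 1$ and let $\Omega\subset\mathbb R^d$ be an open convex polytope: $\overline\Omega$ is the convex hull of a finite set and has nonempty interior $\Omega$. For $f:\overline\Omega\to\mathbb R$ let $u$ be its convex envelope, $$u(x)=\sup\{\,l(x): l \text{ affine},\ l\le f \text{ in } \overline\Omega\,\},\qquad x\in\overline\Omega .$$ For $k\in\{0,1\}$ and $0<\alpha\le 1$, $|g|_{C^{k,\alpha}(\overline\Omega)}$ denotes the least $\alpha$-Hölder constant on $\overline\Omega$ of $g$ (if $k=0$) or of $\nabla g$ (if $k=1$). **Mesh.** Let $\mathcal T_h$ be a finite conforming mesh of $\overline\Omega$ made of closed $d$-simplices $T$, with $h_T=\operatorname{diam}T$ and $\rho_T$ the diameter of the largest ball inscribed in $T$. It has mesh size $h>0$ and is shape-regular and quasi-uniform with constant $\sigma$: $h_T\le\sigma\rho_T$ and $h_T\le h\le\sigma h_T$ for all $T$. The nodes are the vertices of the simplices, and $\mathbb V_h$ is the space of continuous piecewise linear functions over $\mathcal T_h$. **Scheme.** Let $\delta\ge h$ and $0<\theta\le1$. For $x\in\overline\Omega$ let $V(x)$ be the linear space parallel to the face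 of $\overline\Omega$ that contains $x$ in its relative interior ($\overline\Omega$ itself being a face); thus $V(x)=\mathbb R^d$ if $x\in\Omega$, $V(x)=\mathbb R\,e(x)$ with a unit vector $e(x)$ if $x$ is inside an edge, and $V(x)=\{0\}$ if $x$ is a vertex of $\overline\Omega$. For each space $V$ of this form let $\mathbb S_\theta(V)$ be a finite set of unit vectors of $V$ such that every unit vector of $V$ is within distance $\theta$ of an element of $\mathbb S_\theta(V)$. For a node $x_i$ that is not a vertex of $\overline\Omega$, let $\delta_i$ be the largest number in $(0,\delta]$ such that $x_i\pm\delta_i v\in\overline\Omega$ for all unit vectors $v\in V(x_i)$ (so $\delta_i=\min\{\delta,\operatorname{dist}(x_i,\partial\Omega)\}$ if $x_i\in\Omega$), and put $$\nabla^2_\delta w(x_i;v)=\frac{w(x_i+\delta_i v)-2w(x_i)+w(x_i-\delta_i v)}{\delta_i^2}.$$ Let $u_\varepsilon\in\mathbb V_h$, $\varepsilon=(h,\delta,\theta)$, be the discrete solution: $$\min\Big\{f(x_i)-u_\varepsilon(x_i),\ \min_{v\in\mathbb S_\theta(V(x_i))}\nabla^2_\delta u_\varepsilon(x_i;v)\Big\}=0$$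 at every node $x_i$ that is not a vertex of $\overline\Omega$, and $u_\varepsilon(x_i)=f(x_i)$ at the vertices of $\overline\Omega$. For $d=2$, at the nodes inside an edge this is the one-dimensional obstacle problem $\min\{f(x_i)-u_\varepsilon(x_i),\nabla^2_\delta u_\varepsilon(x_i;e(x_i))\}=0$, since $\theta\le 1$ forces $\mathbb S_\theta(\mathbb R\,e)=\{\pm e\}$. **Proposition (convergence rate for polytopes).** Let $k\in\{0,1\}$, $0<\alpha\le1$, $\sigma, M, c_2\in\mathbb R$ and $c_1>0$. There is a constant $C$, depending only on $\Omega,d,\sigma,k,\alpha,c_1,c_2,M$, such that the following holds. If $f,u\in C^{k,\alpha}(\overline\Omega)$ with $|f|_{C^{k,\alpha}(\overline\Omega)}\le M$ and $|u|_{C^{k,\alpha}(\overline\Omega)}\le M$, and if the discretization parameters satisfy $h\le\delta$, $0<\theta\le1$, $$c_1h^{\frac{k+\alpha}{2+k+\alpha}}\le\delta\le c_2h^{\frac{k+\alpha}{2+k+\alpha}},\qquad \theta\le c_2h^{\frac{2}{2+k+\alpha}},$$ then, for every mesh, every choice of directions and every discrete solution $u_\varepsilon$ as above, $$\|u-u_\varepsilon\|_{L^\infty(\Omega)}\le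 C\,h^{\frac{(k+\alpha)^2}{2+k+\alpha}} .$$ -/

import Mathlib

namespace TwoScale

/-- The ambient Euclidean space `ℝ^d`. -/
abbrev Space (d : ℕ) : Type := EuclideanSpace ℝ (Fin d)

variable {d : ℕ}

/-- The convex envelope on the closed domain `P`: the supremum of the affine functions that are
below `f` on `P`. -/
noncomputable def convexEnvelope (P : Set (Space d)) (f : Space d → ℝ) (x : Space d) : ℝ :=
  sSup {y | ∃ l : Space d →ᵃ[ℝ] ℝ, (∀ z ∈ P, l z ≤ f z) ∧ y = l x}

/-- `g ∈ C^{k,α}(P)` with Hölder seminorm `|g|_{C^{k,α}(P)} ≤ M`: `g` is `k` times continuously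
differentiable up to the boundary of `P` and its `k`-th derivative is `α`-Hölder with
constant `M`. For `k = 0` this is `|g x - g y| ≤ M |x - y|^α`, for `k = 1` it is
`|∇g x - ∇g y| ≤ M |x - y|^α`. -/
def IsHolder (k : ℕ) (α M : ℝ) (P : Set (Space d)) (g : Space d → ℝ) : Prop :=
  ContDiffOn ℝ k g P ∧
    ∀ x ∈ P, ∀ y ∈ P,
      ‖iteratedFDerivWithin ℝ k g P x - iteratedFDerivWithin ℝ k g P y‖ ≤ M * ‖x - y‖ ^ α

/-- The closed `d`-simplices (elements) of a simplicial complex in `ℝ^d`, each given by its set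
of vertices. -/
def elements (K : Geometry.SimplicialComplex ℝ (Space d)) : Set (Finset (Space d)) :=
  {T | T ∈ K.faces ∧ T.card = d + 1}

/-- `K` is a finite conforming mesh of `P`, made of `d`-simplices, with mesh size `h`, which is
shape-regular and quasi-uniform with constant `σ`. -/
structure IsMesh (K : Geometry.SimplicialComplex ℝ (Space d)) (P : Set (Space d))
    (σ h : ℝ) : Prop where
  finite : K.faces.Finite
  /-- every face of the mesh is a face of some element -/
  pure : ∀ s ∈ K.faces, ∃ T ∈ elements K, s ⊆ T
  /-- the elements fill the domain -/
  space_eq : K.space = P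
  /-- no element has diameter larger than `h` -/
  diam_le : ∀ T ∈ elements K, Metric.diam (convexHull ℝ (T : Set (Space d))) ≤ h
  /-- shape regularity: `h_T ≤ σ ρ_T`, where `ρ_T` is the diameter of the largest inscribed
  ball, that is, `T` contains a ball of diameter `2 r` with `h_T ≤ σ (2 r)` -/
  shape_regular : ∀ T ∈ elements K, ∃ (c : Space d) (r : ℝ), 0 < r ∧
    Metric.closedBall c r ⊆ convexHull ℝ (T : Set (Space d)) ∧
    Metric.diam (convexHull ℝ (T : Set (Space d))) ≤ σ * (2 * r)
  /-- quasi-uniformity: `h ≤ σ h_T` -/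
  quasi_uniform : ∀ T ∈ elements K, h ≤ σ * Metric.diam (convexHull ℝ (T : Set (Space d)))

/-- The space of continuous piecewise linear functions over the mesh `K` (only the values on
`K.space` matter). -/
def IsPiecewiseLinear (K : Geometry.SimplicialComplex ℝ (Space d)) (w : Space d → ℝ) : Prop :=
  ContinuousOn w K.space ∧
    ∀ T ∈ elements K, ∃ l : Space d →ᵃ[ℝ] ℝ, Set.EqOn w l (convexHull ℝ (T : Set (Space d)))

/-- The linear space parallel to the face of the convex polytope `P` that contains `x` in its
relative interior. It is the whole space if `x` is an interior point, the line parallel to the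
edge if `x` is inside an edge, and trivial precisely if `x` is a vertex. -/
def faceDir (P : Set (Space d)) (x : Space d) : Submodule ℝ (Space d) :=
  Submodule.span ℝ {v | x + v ∈ P ∧ x - v ∈ P}

/-- The step size at `x`: the largest `r ∈ (0, δ]` such that all the points `x ± r v`, `v` a unit
vector parallel to the face containing `x` in its relative interior, are in `P`. For an interior
point this is `min {δ, dist (x, ∂P)}`; for `x` inside an edge with unit vector `e` it is the
largest `r ∈ (0, δ]` with both `x + r e` and `x - r e` in `P`. -/
noncomputable def stepSize (P : Set (Space d)) (δ : ℝ) (x : Space d) : ℝ :=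
  sSup {r | 0 < r ∧ r ≤ δ ∧ ∀ v ∈ faceDir P x, ‖v‖ = 1 → x + r • v ∈ P ∧ x - r • v ∈ P}

/-- The centered second difference of `w` at `x` in the direction `v` with step `r`. -/
noncomputable def secondDiff (w : Space d → ℝ) (r : ℝ) (x v : Space d) : ℝ :=
  (w (x + r • v) - 2 * w x + w (x - r • v)) / r ^ 2

/-- `S` is a `θ`-net, consisting of unit vectors of `V`, of the unit sphere of `V`. -/
def IsSphereNet (V : Submodule ℝ (Space d)) (θ : ℝ) (S : Finset (Space d)) : Prop :=
  (∀ v ∈ S, v ∈ V ∧ ‖v‖ = 1) ∧ ∀ v ∈ V, ‖v‖ = 1 → ∃ v' ∈ S, ‖v - v'‖ ≤ θ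

/-- The two-scale operator
`min {f x - w x, min_{v ∈ S} (w (x + δ_x v) - 2 w x + w (x - δ_x v)) / δ_x ^ 2}`,
with `δ_x = stepSize P δ x` and a nonempty finite set `S` of directions. -/
noncomputable def twoScaleOp (P : Set (Space d)) (δ : ℝ) (S : Finset (Space d))
    (f w : Space d → ℝ) (x : Space d) : ℝ :=
  min (f x - w x) (sInf ((fun v => secondDiff w (stepSize P δ x) x v) '' (S : Set (Space d))))

/-- `w` is a solution of the discrete system on the polytope `P`, with `𝕊 V` the discrete
directions used in the faces of `P` that are parallel to `V`. The nodes are the vertices of the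
mesh `K`. At a node that is a vertex of `P` the value `f x` is prescribed; at any other node the
two-scale obstacle problem is imposed within the face that contains it in its relative interior,
that is, with `𝕊 ⊤` at the interior nodes, and (for `d = 2`, `θ ≤ 1`) in the directions `± e x`
at the nodes inside an edge. -/
def IsDiscreteSolution (P : Set (Space d)) (K : Geometry.SimplicialComplex ℝ (Space d)) (δ : ℝ)
    (𝕊 : Submodule ℝ (Space d) → Finset (Space d)) (f w : Space d → ℝ) : Prop :=
  IsPiecewiseLinear K w ∧
    ∀ x ∈ K.vertices,
      (faceDir P x = ⊥ → w x = f x) ∧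
      (faceDir P x ≠ ⊥ → twoScaleOp P δ (𝕊 (faceDir P x)) f w x = 0)

end TwoScale

open Filter Topology

namespace TwoScale

variable {d : ℕ}

/-! Write s = k + α, u for the envelope and w for the discrete solution. Regularity enters only
through `HasTaylor`: near each point f and u are linear up to M|z - y|^s. Hence second differences
with step r are at most 2M r^s, and interpolating u at the nodes costs at most M h^s.

Lower bound, u ≤ w at the nodes (`IsDiscreteSolution.envelope_le`): u is convex and below f. Adding
τ(|z|² - R²) makes it strictly convex without raising it, so at a node minimizing the difference no
second difference of w can vanish. There w = f, and the difference is nonnegative.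

Upper bound, by induction on the dimension of the face (`IsDiscreteSolution.face_step`). Maximize w
- u - B over the nodes of one face, where B = A g(D) + A' δ^s (R² - |y|²), D is the distance to the
relative boundary and g is the concave function of `exists_barrier`. Second differences of w are
nonnegative, so at the maximum the second differences of -B are bounded by those of u plus 2M h^s.
Let r be the step at the maximum. If D = 0, the node lies in a smaller face and the induction
hypothesis applies. If 0 < D ≤ 2(d+2)δ, a direction close to the one towards the boundary makes A
g(D) contribute A c r^s. This beats the 2M r^s of u and the 2M h^s of interpolation, since nodes off
the relative boundary are at distance at least h/σ² from it (`IsMesh.le_faceDist`): a contradiction.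
If D is larger, then r = δ, and u is affine on a segment from x through which a contact point z is
seen with weight at least 1/(d+2) (`exists_contact_segment`). If z is within (d+2)δ, then f - u,
which is nonnegative and vanishes at z, is O(δ^s) at x (`sub_le_of_near_contact`), and w ≤ f. If z
is farther away, u has no second difference along z - x at step δ; the nearest admissible direction
changes this by only O((θδ)^s) (`second_diff_shift_le`). As θδ = O(h), everything is O(h^s), which
the quadratic part of B, worth 2A' δ^s δ², exceeds: a contradiction.

The scalings thus come from θδ ≲ h and h^s ≲ δ^(2+s). The error is O(δ^s), and δ^s is of order
h^(s²/(2+s)). -/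

/-- `g` has at each point of `P` a linear approximation on `P` with error `M ‖z - y‖ ^ s`. -/
def HasTaylor (s M : ℝ) (P : Set (Space d)) (g : Space d → ℝ) : Prop :=
  ∀ y ∈ P, ∃ L : Space d →L[ℝ] ℝ, ∀ z ∈ P, |g z - g y - L (z - y)| ≤ M * ‖z - y‖ ^ s

theorem IsHolder.hasTaylor {k : ℕ} (hk : k = 0 ∨ k = 1) {α M : ℝ} (hα : 0 < α)
    {P : Set (Space d)} (hc : Convex ℝ P) (hi : (interior P).Nonempty) {g : Space d → ℝ}
    (hg : IsHolder k α M P g) : HasTaylor (k + α) |M| P g := by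
  obtain ⟨hd, hH⟩ := hg
  have habs : ∀ t : ℝ, 0 ≤ t → M * t ^ α ≤ |M| * t ^ α := fun t ht =>
    mul_le_mul_of_nonneg_right (le_abs_self M) (Real.rpow_nonneg ht _)
  intro y hy
  rcases hk with rfl | rfl
  · refine ⟨0, fun z hz => ?_⟩
    have h := hH z hz y hy
    rw [iteratedFDerivWithin_zero_eq_comp, Function.comp_apply, Function.comp_apply, ← map_sub,
      LinearIsometryEquiv.norm_map, Real.norm_eq_abs] at h
    simpa using h.trans (habs _ (norm_nonneg _))
  · refine ⟨fderivWithin ℝ g P y, fun z hz => ?_⟩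
    have hu : UniqueDiffOn ℝ P := uniqueDiffOn_convex hc hi
    have hdiff : DifferentiableOn ℝ g P := hd.differentiableOn (by simp)
    have hsub : segment ℝ y z ⊆ P := hc.segment_subset hy hz
    have hb : ∀ x ∈ segment ℝ y z,
        ‖fderivWithin ℝ g P x - fderivWithin ℝ g P y‖ ≤ |M| * ‖z - y‖ ^ α := by
      intro x hx
      have hxP := hsub hx
      have h1 : ‖fderivWithin ℝ g P x - fderivWithin ℝ g P y‖ ≤ M * ‖x - y‖ ^ α := by
        refine le_trans ?_ (hH x hxP y hy)
        refine ContinuousLinearMap.opNorm_le_bound _ (norm_nonneg _) fun v => ?_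
        have h2 := (iteratedFDerivWithin ℝ 1 g P x
          - iteratedFDerivWithin ℝ 1 g P y).le_opNorm (fun _ => v)
        simpa [iteratedFDerivWithin_one_apply (hu x hxP),
          iteratedFDerivWithin_one_apply (hu y hy)] using h2
      refine h1.trans ((habs _ (norm_nonneg _)).trans ?_)
      refine mul_le_mul_of_nonneg_left (Real.rpow_le_rpow (norm_nonneg _) ?_ hα.le) (abs_nonneg _)
      obtain ⟨a, b, ha, hb, hab, rfl⟩ := hx
      have : a • y + b • z - y = b • (z - y) := by
        rw [show a = 1 - b by linarith]; module
      rw [this, norm_smul, Real.norm_eq_abs, abs_of_nonneg hb]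
      exact mul_le_of_le_one_left (norm_nonneg _) (by linarith)
    have h := Convex.norm_image_sub_le_of_norm_hasFDerivWithin_le'
      -- The mean value inequality is used on the segment alone: there the gradient varies by at
      -- most |M|‖z - y‖^α, and the length supplies the missing power ‖z - y‖.
      (fun x hx => ((hdiff x (hsub hx)).hasFDerivWithinAt.mono hsub)) hb (convex_segment y z)
      (left_mem_segment ℝ y z) (right_mem_segment ℝ y z)
    rw [Real.norm_eq_abs] at h
    refine h.trans (le_of_eq ?_)
    rcases eq_or_ne z y with rfl | hne
    · simp [Real.zero_rpow hα.ne', Real.zero_rpow (by positivity : (1 + α) ≠ 0)]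
    · have : 0 < ‖z - y‖ := norm_pos_iff.2 (sub_ne_zero.2 hne)
      rw [Nat.cast_one, Real.rpow_add this, Real.rpow_one]; ring

theorem exists_rest_of_combo {P : Set (Space d)} (hP : Convex ℝ P) {T : Finset (Space d)}
    {c : Space d → ℝ} (hc : ∀ z ∈ T, 0 ≤ c z) (h1 : ∑ z ∈ T, c z = 1) (hT : ∀ z ∈ T, z ∈ P)
    {x : Space d} (hx : x ∈ T) :
    c x ≤ 1 ∧ ∃ q ∈ P, ∑ z ∈ T, c z • z = c x • x + (1 - c x) • q := by
  classical
  have hsplit := Finset.add_sum_erase T c hx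
  have hsplit' := Finset.add_sum_erase T (fun w => c w • w) hx
  have hc' : ∀ w ∈ T.erase x, 0 ≤ c w := fun w hw => hc w (Finset.mem_of_mem_erase hw)
  have hrest : 0 ≤ ∑ w ∈ T.erase x, c w := Finset.sum_nonneg hc'
  refine ⟨by linarith, ?_⟩
  rcases hrest.eq_or_lt with h0 | hpos
  -- The remaining weight is zero, so the second point is immaterial.
  · refine ⟨x, hT x hx, ?_⟩
    have hz0 := (Finset.sum_eq_zero_iff_of_nonneg hc').1 h0.symm
    rw [← hsplit', Finset.sum_eq_zero fun w hw => by rw [hz0 w hw, zero_smul]]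
    rw [show c x = 1 by linarith]
    simp
  · set ρ := ∑ w ∈ T.erase x, c w
    refine ⟨∑ w ∈ T.erase x, (c w / ρ) • w, hP.sum_mem (fun w hw => div_nonneg (hc' w hw) hrest)
      (by rw [← Finset.sum_div, div_self hpos.ne'])
      (fun w hw => hT w (Finset.mem_of_mem_erase hw)), ?_⟩
    rw [← hsplit', show 1 - c x = ρ by linarith, Finset.smul_sum]
    simp only [smul_smul, mul_div_cancel₀ _ hpos.ne']

/-! ### Second differences and interpolation errors from Taylor estimates -/

section Taylor

variable {s M : ℝ} {P : Set (Space d)} {g g' : Space d → ℝ}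

theorem HasTaylor.sub {M' : ℝ} (hg : HasTaylor s M P g) (hg' : HasTaylor s M' P g') :
    HasTaylor s (M + M') P (g - g') := by
  intro y hy
  obtain ⟨L, hL⟩ := hg y hy
  obtain ⟨L', hL'⟩ := hg' y hy
  refine ⟨L - L', fun z hz => ?_⟩
  have h1 := hL z hz
  have h2 := hL' z hz
  have : (g - g') z - (g - g') y - (L - L') (z - y)
      = (g z - g y - L (z - y)) - (g' z - g' y - L' (z - y)) := by
    simp only [Pi.sub_apply, sub_apply]; ring
  rw [this, add_mul]
  exact (abs_sub _ _).trans (add_le_add h1 h2)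

theorem HasTaylor.second_diff_le (hg : HasTaylor s M P g) {p w : Space d} (hp : p ∈ P)
    (h1 : p + w ∈ P) (h2 : p - w ∈ P) : g (p + w) + g (p - w) - 2 * g p ≤ 2 * M * ‖w‖ ^ s := by
  obtain ⟨L, hL⟩ := hg p hp
  have e1 := (abs_le.1 (hL _ h1)).2
  have e2 := (abs_le.1 (hL _ h2)).2
  rw [add_sub_cancel_left] at e1
  rw [sub_sub_cancel_left, norm_neg, map_neg] at e2
  linarith

/-- The linear part averages to zero because y is the barycentre, so only the remainders survive.
This controls the interpolation error of u. -/
theorem HasTaylor.sum_sub_le (hg : HasTaylor s M P g) (hs : 0 ≤ s) (hM : 0 ≤ M) {h : ℝ}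
    {T : Finset (Space d)} {c : Space d → ℝ} (hc : ∀ z ∈ T, 0 ≤ c z) (h1 : ∑ z ∈ T, c z = 1)
    {y : Space d} (hy : y ∈ P) (hsum : ∑ z ∈ T, c z • z = y) (hT : ∀ z ∈ T, z ∈ P)
    (hh : ∀ z ∈ T, ‖z - y‖ ≤ h) : ∑ z ∈ T, c z * g z - g y ≤ M * h ^ s := by
  obtain ⟨L, hL⟩ := hg y hy
  have hz : ∑ z ∈ T, c z * L (z - y) = 0 := by
    have : ∑ z ∈ T, c z • (z - y) = 0 := by
      simp only [smul_sub, Finset.sum_sub_distrib, hsum, ← Finset.sum_smul, h1, one_smul, sub_self]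
    simpa [map_sum, map_smul] using congrArg L this
  have hgy : g y = ∑ z ∈ T, c z * g y := by rw [← Finset.sum_mul, h1, one_mul]
  have hMh : M * h ^ s = ∑ z ∈ T, c z * (M * h ^ s) := by rw [← Finset.sum_mul, h1, one_mul]
  have key : ∑ z ∈ T, c z * g z - g y = ∑ z ∈ T, c z * (g z - g y - L (z - y)) := by
    simp only [mul_sub, Finset.sum_sub_distrib]
    rw [← hgy, hz, sub_zero]
  rw [key, hMh]
  refine Finset.sum_le_sum fun z hzT => mul_le_mul_of_nonneg_left ?_ (hc z hzT)
  refine (le_abs_self _).trans ((hL z (hT z hzT)).trans ?_)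
  exact mul_le_mul_of_nonneg_left (Real.rpow_le_rpow (norm_nonneg _) (hh z hzT) hs) hM

end Taylor

theorem sum_eq_sum_embedding {ι κ F : Type*} [Fintype ι] [Fintype κ] [AddCommMonoid F] (e : ι ↪ κ)
    (φ : κ → F) (hφ : ∀ j, j ∉ Set.range e → φ j = 0) : ∑ j, φ j = ∑ i, φ (e i) := by
  rw [← Finset.sum_map Finset.univ e φ]
  refine (Finset.sum_subset (Finset.subset_univ _) fun j _ hj => hφ j ?_).symm
  simpa using hj

/-- The convex hull of a compact set in a finite-dimensional space is compact. -/
theorem isCompact_convexHull_of_isCompact {E : Type*} [NormedAddCommGroup E] [NormedSpace ℝ E]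
    [FiniteDimensional ℝ E] {G : Set E} (hG : IsCompact G) : IsCompact (convexHull ℝ G) := by
  classical
  rcases G.eq_empty_or_nonempty with rfl | ⟨z₀, hz₀⟩
  · simp
  -- By Carathéodory the hull is a continuous image of simplex × Gⁿ; shorter combinations are padded
  -- by the point z₀ with weight 0.
  set n := Module.finrank ℝ E + 1
  have hK : IsCompact (stdSimplex ℝ (Fin n) ×ˢ Set.univ.pi fun _ : Fin n => G) :=
    (isCompact_stdSimplex ℝ _).prod (isCompact_univ_pi fun _ => hG)
  have hcont : Continuous fun p : (Fin n → ℝ) × (Fin n → E) => ∑ i, p.1 i • p.2 i := by fun_prop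
  convert hK.image hcont using 1
  ext x
  constructor
  · intro hx
    obtain ⟨ι, _, z, w, hz, hind, hw, hw1, rfl⟩ := eq_pos_convex_span_of_mem_convexHull hx
    have hcard : Fintype.card ι ≤ Fintype.card (Fin n) := by
      rw [Fintype.card_fin]
      exact hind.card_le_finrank_succ.trans (Nat.succ_le_succ (Submodule.finrank_le _))
    obtain ⟨e⟩ := Function.Embedding.nonempty_of_card_le hcard
    have hext : ∀ j, j ∉ Set.range e → Function.extend e w 0 j = 0 := fun j hj => by
      rw [Function.extend_apply' _ _ _ (by simpa using hj)]; rfl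
    refine ⟨(Function.extend e w 0, Function.extend e z fun _ => z₀), ⟨⟨fun j => ?_, ?_⟩, ?_⟩, ?_⟩
    · dsimp only
      by_cases hj : j ∈ Set.range e
      · obtain ⟨i, rfl⟩ := hj
        rw [e.injective.extend_apply]; exact (hw i).le
      · exact (hext j hj).ge
    · dsimp only
      rw [sum_eq_sum_embedding e _ hext, ← hw1]
      exact Finset.sum_congr rfl fun i _ => e.injective.extend_apply _ _ _
    · intro j _
      dsimp only
      by_cases hj : j ∈ Set.range e
      · obtain ⟨i, rfl⟩ := hj
        rw [e.injective.extend_apply]; exact hz ⟨i, rfl⟩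
      · rwa [Function.extend_apply' _ _ _ (by simpa using hj)]
    · dsimp only
      rw [sum_eq_sum_embedding e _ fun j hj => by rw [hext j hj, zero_smul]]
      exact Finset.sum_congr rfl fun i _ => by
        rw [e.injective.extend_apply, e.injective.extend_apply]
  · rintro ⟨⟨w, z⟩, ⟨⟨hw, hw1⟩, hz⟩, rfl⟩
    exact (convex_convexHull ℝ G).sum_mem (fun i _ => hw i) hw1
      fun i _ => subset_convexHull ℝ G (hz i trivial)

/-! ### The convex envelope and its contact points -/

section Envelope

variable {P : Set (Space d)} {f : Space d → ℝ}

theorem convexEnvelope_bddAbove {x : Space d} (hx : x ∈ P) :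
    BddAbove {y | ∃ l : Space d →ᵃ[ℝ] ℝ, (∀ z ∈ P, l z ≤ f z) ∧ y = l x} :=
  ⟨f x, by rintro _ ⟨l, hl, rfl⟩; exact hl x hx⟩

theorem le_convexEnvelope {x : Space d} (hx : x ∈ P) {l : Space d →ᵃ[ℝ] ℝ}
    (hl : ∀ z ∈ P, l z ≤ f z) : l x ≤ convexEnvelope P f x :=
  le_csSup (convexEnvelope_bddAbove hx) ⟨l, hl, rfl⟩

/-- The affine function with linear part `L` and value `c` at `x`. -/
noncomputable def affineOf (L : Space d →L[ℝ] ℝ) (x : Space d) (c : ℝ) : Space d →ᵃ[ℝ] ℝ :=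
  (L : Space d →ₗ[ℝ] ℝ).toAffineMap + AffineMap.const ℝ _ (c - L x)

theorem affineOf_apply (L : Space d →L[ℝ] ℝ) (x : Space d) (c : ℝ) (z : Space d) :
    affineOf L x c z = c + L (z - x) := by
  simp [affineOf, map_sub]; ring

theorem exists_affine_le (hP : IsCompact P) (hf : ContinuousOn f P) (hne : P.Nonempty) :
    ∃ l : Space d →ᵃ[ℝ] ℝ, ∀ z ∈ P, l z ≤ f z := by
  obtain ⟨x, _, hm⟩ := hP.exists_isMinOn hne hf
  exact ⟨affineOf 0 x (f x), fun z hz => by simpa [affineOf_apply] using hm hz⟩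

theorem convexEnvelope_le (hP : IsCompact P) (hf : ContinuousOn f P) {x : Space d} (hx : x ∈ P)
    {c : ℝ} (h : ∀ l : Space d →ᵃ[ℝ] ℝ, (∀ z ∈ P, l z ≤ f z) → l x ≤ c) :
    convexEnvelope P f x ≤ c := by
  obtain ⟨l, hl⟩ := exists_affine_le hP hf ⟨x, hx⟩
  refine csSup_le ⟨_, l, hl, rfl⟩ ?_
  rintro _ ⟨l, hl, rfl⟩
  exact h l hl

theorem convexEnvelope_le_self (hP : IsCompact P) (hf : ContinuousOn f P) {x : Space d}
    (hx : x ∈ P) : convexEnvelope P f x ≤ f x :=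
  convexEnvelope_le hP hf hx fun _ hl => hl x hx

theorem affine_combo (l : Space d →ᵃ[ℝ] ℝ) (x y : Space d) {a b : ℝ} (hab : a + b = 1) :
    l (a • x + b • y) = a * l x + b * l y := by
  simpa using Convex.combo_affine_apply (f := l) (x := x) (y := y) hab

theorem convexOn_convexEnvelope (hP : IsCompact P) (hc : Convex ℝ P) (hf : ContinuousOn f P) :
    ConvexOn ℝ P (convexEnvelope P f) := by
  refine ⟨hc, fun x hx y hy a b ha hb hab => ?_⟩
  refine convexEnvelope_le hP hf (hc hx hy ha hb hab) fun l hl => ?_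
  rw [affine_combo l x y hab]
  exact add_le_add (mul_le_mul_of_nonneg_left (le_convexEnvelope hx hl) ha)
    (mul_le_mul_of_nonneg_left (le_convexEnvelope hy hl) hb)

theorem sub_convexEnvelope_le {s M R : ℝ} (hs : 0 ≤ s) (hM : 0 ≤ M) (hT : HasTaylor s M P f)
    (hR : ∀ x ∈ P, ∀ y ∈ P, ‖x - y‖ ≤ R) {x : Space d} (hx : x ∈ P) :
    f x - convexEnvelope P f x ≤ M * R ^ s := by
  obtain ⟨L, hL⟩ := hT x hx
  have h := le_convexEnvelope (f := f) hx (l := affineOf L x (f x - M * R ^ s)) fun z hz => by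
    rw [affineOf_apply]
    have h1 := (abs_le.1 (hL z hz)).1
    have h2 : M * ‖z - x‖ ^ s ≤ M * R ^ s :=
      mul_le_mul_of_nonneg_left (Real.rpow_le_rpow (norm_nonneg _) (hR z hz x hx) hs) hM
    linarith
  rw [affineOf_apply, sub_self, map_zero] at h
  linarith

/-- The envelope is attained by a convex combination of values of `f`. -/
theorem exists_convexEnvelope_eq_sum (hP : IsCompact P) (hf : ContinuousOn f P) {x : Space d}
    (hx : x ∈ P) : ∃ (ι : Type) (_ : Fintype ι) (z : ι → Space d) (w : ι → ℝ),
      (∀ i, z i ∈ P) ∧ (∀ i, 0 < w i) ∧ ∑ i, w i = 1 ∧ Fintype.card ι ≤ d + 2 ∧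
      ∑ i, w i • z i = x ∧ ∑ i, w i * f (z i) ≤ convexEnvelope P f x := by
  set G : Set (Space d × ℝ) := (fun z => (z, f z)) '' P
  have hG : IsCompact G := hP.image_of_continuousOn (continuousOn_id.prodMk hf)
  have hC := isCompact_convexHull_of_isCompact hG
  have hxC : (x, f x) ∈ convexHull ℝ G := subset_convexHull ℝ G ⟨x, hx, rfl⟩
  have hS : IsCompact (convexHull ℝ G ∩ {p | p.1 = x}) :=
    hC.inter_right (isClosed_eq continuous_fst continuous_const)
  obtain ⟨⟨x', y⟩, ⟨hyC, hxx⟩, hmin⟩ :=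
    hS.exists_isMinOn ⟨(x, f x), hxC, rfl⟩ continuous_snd.continuousOn
  simp only [Set.mem_ofPred_eq] at hxx
  subst hxx
  have hyle : y ≤ convexEnvelope P f x' := by
    -- The point at height y - ε lies strictly below the compact hull of the graph. A separating
    -- hyperplane is not vertical, since it separates two points over the same x', so it is the
    -- graph of an affine function below f.
    refine le_of_forall_pos_sub_le fun ε hε => ?_
    have hnot : (x', y - ε) ∉ convexHull ℝ G := fun hmem => by
      have := hmin (show (x', y - ε) ∈ convexHull ℝ G ∩ {p | p.1 = x'} from ⟨hmem, rfl⟩)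
      simp only [Set.mem_ofPred_eq] at this
      linarith
    obtain ⟨F, c, hF1, hF2⟩ :=
      geometric_hahn_banach_point_closed (convex_convexHull ℝ G) hC.isClosed hnot
    have hdec : ∀ (z : Space d) (t : ℝ), F (z, t) = F (z, 0) + t * F (0, 1) := fun z t => by
      have : (z, t) = (z, (0 : ℝ)) + t • ((0 : Space d), (1 : ℝ)) := by simp
      rw [this, map_add, map_smul, smul_eq_mul]
    set q := F (0, 1)
    set p : Space d →L[ℝ] ℝ := F.comp (ContinuousLinearMap.inl ℝ _ _)
    have hp : ∀ z, F (z, 0) = p z := fun z => rfl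
    have h2 := hF2 _ hyC
    rw [hdec, hp] at hF1 h2
    have hq : 0 < q := by
      by_contra hq
      nlinarith
    have := le_convexEnvelope (f := f) hx (l := affineOf (-(q⁻¹ • p)) x' (y - ε)) fun z hz => by
      have h3 := hF2 _ (subset_convexHull ℝ G ⟨z, hz, rfl⟩)
      dsimp only at h3
      rw [hdec, hp] at h3
      rw [affineOf_apply, neg_apply, smul_apply, map_sub,
        smul_eq_mul]
      have h4 : p x' - p z ≤ q * (f z - (y - ε)) := by linarith
      have h5 : q⁻¹ * (p x' - p z) ≤ f z - (y - ε) := by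
        rwa [inv_mul_le_iff₀ hq]
      linarith
    rw [affineOf_apply, sub_self, map_zero] at this
    linarith
  obtain ⟨ι, _, z, w, hz, hind, hw, hw1, hsum⟩ := eq_pos_convex_span_of_mem_convexHull hyC
  -- Carathéodory is applied in dimension d + 1, to the graph.
  have hcard : Fintype.card ι ≤ d + 2 := by
    refine hind.card_le_finrank_succ.trans (Nat.succ_le_succ ((Submodule.finrank_le _).trans ?_))
    simp
  have hzG : ∀ i, (z i).1 ∈ P ∧ (z i).2 = f (z i).1 := fun i => by
    obtain ⟨v, hv, hvz⟩ := hz ⟨i, rfl⟩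
    rw [← hvz]; exact ⟨hv, rfl⟩
  set e := Fintype.equivFin ι
  refine ⟨Fin (Fintype.card ι), inferInstance, fun j => (z (e.symm j)).1, fun j => w (e.symm j),
    fun j => (hzG _).1, fun j => hw _, ?_, by simpa using hcard, ?_, ?_⟩
  · rw [← hw1]; exact e.symm.sum_comp w
  · rw [e.symm.sum_comp fun i => w i • (z i).1]
    have := congrArg Prod.fst hsum
    simpa [Prod.fst_sum] using this
  · rw [e.symm.sum_comp fun i => w i * f (z i).1]
    have := congrArg Prod.snd hsum
    simp only [Prod.snd_sum, Prod.smul_snd, smul_eq_mul] at this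
    refine le_trans (le_of_eq ?_) (this.trans_le hyle)
    exact Finset.sum_congr rfl fun i _ => by rw [(hzG i).2]

/-- Each point lies on a segment on which the envelope is affine, and one end of which is a contact
point whose weight is not small. -/
theorem exists_contact_segment (hP : IsCompact P) (hc : Convex ℝ P) (hf : ContinuousOn f P)
    {x : Space d} (hx : x ∈ P) : ∃ z ∈ P, ∃ q ∈ P, ∃ a : ℝ, 1 / (d + 2) ≤ a ∧ a ≤ 1 ∧
      x = a • z + (1 - a) • q ∧ convexEnvelope P f z = f z ∧
      a * convexEnvelope P f z + (1 - a) * convexEnvelope P f q ≤ convexEnvelope P f x := by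
  classical
  set u := convexEnvelope P f
  obtain ⟨ι, _, z, w, hz, hw, hw1, hcard, hsum, hval⟩ := exists_convexEnvelope_eq_sum hP hf hx
  have hu : ConvexOn ℝ P u := convexOn_convexEnvelope hP hc hf
  have hle : ∀ i, u (z i) ≤ f (z i) := fun i => convexEnvelope_le_self hP hf (hz i)
  have hux : u x ≤ ∑ i, w i * u (z i) := by
    rw [← hsum]
    simpa using hu.map_sum_le (t := Finset.univ) (fun i _ => (hw i).le) hw1 fun i _ => hz i
  -- Convexity of u and u ≤ f squeeze the two averages together; as all weights are positive, every
  -- point is a contact point.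
  have hcontact : ∀ i, u (z i) = f (z i) := by
    have hge : ∑ i, w i * (f (z i) - u (z i)) ≤ 0 := by
      simp only [mul_sub, Finset.sum_sub_distrib]; linarith
    have hnn : ∀ i ∈ Finset.univ, 0 ≤ w i * (f (z i) - u (z i)) := fun i _ =>
      mul_nonneg (hw i).le (sub_nonneg.2 (hle i))
    have h0 := (Finset.sum_eq_zero_iff_of_nonneg hnn).1 (le_antisymm hge (Finset.sum_nonneg hnn))
    intro i
    have := (mul_eq_zero.1 (h0 i (Finset.mem_univ i))).resolve_left (hw i).ne'
    linarith
  have hι : Nonempty ι := by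
    by_contra hempty
    rw [not_nonempty_iff] at hempty
    simp at hw1
  -- The largest of at most d + 2 weights is at least 1/(d+2); the other points are merged into q.
  obtain ⟨j, -, hj⟩ := Finset.exists_max_image Finset.univ w Finset.univ_nonempty
  have hja : 1 / ((d : ℝ) + 2) ≤ w j := by
    have h1 : (1 : ℝ) ≤ Fintype.card ι * w j := by
      rw [← hw1]
      have := Finset.sum_le_card_nsmul Finset.univ w (w j) hj
      simpa using this
    have h2 : (Fintype.card ι : ℝ) ≤ d + 2 := by exact_mod_cast hcard
    rw [div_le_iff₀ (by positivity)]
    nlinarith [hw j]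
  have hsplit : ∀ {F : Type} [AddCommGroup F] (φ : ι → F),
      ∑ i, φ i = φ j + ∑ i ∈ Finset.univ.erase j, φ i := fun φ =>
    (Finset.add_sum_erase _ φ (Finset.mem_univ j)).symm
  have hrest : ∑ i ∈ Finset.univ.erase j, w i = 1 - w j := by
    have := hsplit w; linarith
  have hrest0 : 0 ≤ 1 - w j := by
    rw [← hrest]; exact Finset.sum_nonneg fun i _ => (hw i).le
  have hux' : ∑ i, w i * u (z i) ≤ u x := by
    refine le_trans (le_of_eq ?_) hval
    exact Finset.sum_congr rfl fun i _ => by rw [hcontact i]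
  rcases hrest0.eq_or_lt with h0 | hpos
  · have hempty : ∀ i ∈ Finset.univ.erase j, w i = 0 :=
      (Finset.sum_eq_zero_iff_of_nonneg fun i _ => (hw i).le).1 (by rw [hrest, ← h0])
    have he : Finset.univ.erase j = ∅ := by
      by_contra hne
      obtain ⟨i, hi⟩ := Finset.nonempty_of_ne_empty hne
      exact (hw i).ne' (hempty i hi)
    refine ⟨z j, hz j, z j, hz j, w j, hja, by linarith, ?_, hcontact j, ?_⟩
    · rw [← hsum, hsplit, he, ← h0]; simp
    · rw [hsplit, he] at hux'; rw [← h0]; simpa using hux'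
  · set c : ι → ℝ := fun i => w i / (1 - w j)
    have hc0 : ∀ i ∈ Finset.univ.erase j, 0 ≤ c i := fun i _ => div_nonneg (hw i).le hpos.le
    have hc1 : ∑ i ∈ Finset.univ.erase j, c i = 1 := by
      rw [← Finset.sum_div, hrest, div_self hpos.ne']
    have hcw : ∀ i, (1 - w j) * c i = w i := fun i => mul_div_cancel₀ _ hpos.ne'
    refine ⟨z j, hz j, ∑ i ∈ Finset.univ.erase j, c i • z i,
      hc.sum_mem hc0 hc1 fun i _ => hz i, w j, hja, by linarith, ?_, hcontact j, ?_⟩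
    · rw [← hsum, hsplit, Finset.smul_sum]
      simp only [smul_smul, hcw]
    · have hq := hu.map_sum_le hc0 hc1 fun i _ => hz i
      have hq' := mul_le_mul_of_nonneg_left hq hpos.le
      rw [Finset.mul_sum] at hq'
      simp only [smul_eq_mul, ← mul_assoc, hcw] at hq'
      rw [hsplit] at hux'
      linarith

end Envelope

/-! ### Faces of a convex set and the distance to their relative boundary -/

section Faces

variable {P : Set (Space d)} {V : Submodule ℝ (Space d)} {x₀ : Space d}

theorem sub_mem_faceDir_of_combo (hc : Convex ℝ P) {x a q : Space d} (ha : a ∈ P) (hq : q ∈ P)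
    {κ : ℝ} (h0 : 0 < κ) (h1 : κ ≤ 1) (hx : x = κ • a + (1 - κ) • q) : a - x ∈ faceDir P x := by
  have hxP : x ∈ P := hx ▸ hc ha hq h0.le (by linarith) (by ring)
  have hmem : κ • (a - x) ∈ faceDir P x := by
    refine Submodule.subset_span ⟨?_, ?_⟩
    · have : x + κ • (a - x) = (1 - κ) • x + κ • a := by module
      rw [this]
      exact hc hxP ha (by linarith) h0.le (by ring)
    · have : x - κ • (a - x) = κ • x + (1 - κ) • q := by
        have h2 : (1 - κ) • q = x - κ • a := by rw [hx]; module
        rw [h2]; module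
      rw [this]
      exact hc hxP hq h0.le (by linarith) (by ring)
  simpa [smul_smul, inv_mul_cancel₀ h0.ne'] using (faceDir P x).smul_mem κ⁻¹ hmem

/-- The admissible displacements form a symmetric convex set spanning the face direction. It has an
interior point p in that space, and averaging p with -p puts 0 in the interior. -/
theorem exists_ball_faceDir (hc : Convex ℝ P) {x : Space d} (hx : x ∈ P) :
    ∃ r > 0, ∀ v ∈ faceDir P x, ‖v‖ ≤ r → x + v ∈ P := by
  set S : Set (Space d) := {v | x + v ∈ P ∧ x - v ∈ P}
  set W := faceDir P x
  set S' : Set W := (↑) ⁻¹' S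
  have hSc : Convex ℝ S := by
    intro v hv w hw a b ha hb hab
    have hb' : b = 1 - a := by linarith
    constructor
    · have : x + (a • v + b • w) = a • (x + v) + b • (x + w) := by subst hb'; module
      rw [this]; exact hc hv.1 hw.1 ha hb hab
    · have : x - (a • v + b • w) = a • (x - v) + b • (x - w) := by subst hb'; module
      rw [this]; exact hc hv.2 hw.2 ha hb hab
  have hS'c : Convex ℝ S' := hSc.linear_preimage W.subtype
  have h0 : (0 : W) ∈ S' := by simp [S', S, hx]
  have hspan : Submodule.span ℝ S' = ⊤ := Submodule.span_span_coe_preimage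
  have hint : (interior S').Nonempty := by
    rw [hS'c.interior_nonempty_iff_affineSpan_eq_top]
    have := affineSpan_insert_zero (k := ℝ) S'
    rw [Set.insert_eq_of_mem h0, hspan] at this
    exact SetLike.coe_injective (by simpa using this)
  obtain ⟨p, hp⟩ := hint
  have hnp : -p ∈ S' := by
    have := interior_subset hp
    simp only [S', S, Set.mem_preimage, Set.mem_ofPred_eq] at this ⊢
    simpa [← sub_eq_add_neg] using this.symm
  have h0i : (0 : W) ∈ interior S' := by
    have := hS'c.combo_interior_self_mem_interior hp hnp (a := 1 / 2) (b := 1 / 2) (by norm_num)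
      (by norm_num) (by norm_num)
    simpa using this
  obtain ⟨r, hr, hball⟩ := Metric.isOpen_iff.1 isOpen_interior _ h0i
  refine ⟨r / 2, by positivity, fun v hv hvr => ?_⟩
  have : (⟨v, hv⟩ : W) ∈ S' := interior_subset (hball (by
    rw [mem_ball_zero_iff]; change ‖v‖ < r; linarith))
  exact this.1

/-- Faces are extreme: extending the segment from y slightly beyond x₀ exhibits x₀ as a combination
with positive weight on y, hence on a. -/
theorem sub_mem_faceDir_of_mem_face (hc : Convex ℝ P) (hx₀ : x₀ ∈ P) {y a b : Space d}
    (hy : y - x₀ ∈ faceDir P x₀) (ha : a ∈ P) (hb : b ∈ P) {κ : ℝ} (h0 : 0 < κ)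
    (h1 : κ ≤ 1) (hyab : y = κ • a + (1 - κ) • b) : a - x₀ ∈ faceDir P x₀ := by
  obtain ⟨r, hr, hball⟩ := exists_ball_faceDir hc hx₀
  obtain ⟨t, ht, htr⟩ : ∃ t > 0, t * ‖y - x₀‖ ≤ r := by
    refine ⟨r / (‖y - x₀‖ + 1), by positivity, ?_⟩
    rw [div_mul_eq_mul_div, div_le_iff₀ (by positivity)]
    nlinarith [norm_nonneg (y - x₀)]
  have hy' : x₀ + (-t) • (y - x₀) ∈ P := hball _ (Submodule.smul_mem _ _ hy) (by
    rwa [norm_smul, norm_neg, Real.norm_of_nonneg ht.le])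
  -- Chosen so that x₀ = μ y + (1 - μ) y', where y' = x₀ - t(y - x₀) is the point beyond x₀.
  set μ := t / (1 + t)
  have hμ0 : 0 < μ := by positivity
  have hμ1 : μ < 1 := (div_lt_one (by positivity)).2 (by linarith)
  have hμκ : μ * κ < 1 := by nlinarith
  have hsub : 0 < 1 - μ * κ := by linarith
  set q := (μ * (1 - κ) / (1 - μ * κ)) • b + ((1 - μ) / (1 - μ * κ)) • (x₀ + (-t) • (y - x₀))
  have hq : q ∈ P := hc hb hy' (div_nonneg (mul_nonneg hμ0.le (by linarith)) hsub.le)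
    (div_nonneg (by linarith) hsub.le) (by field_simp; ring)
  refine sub_mem_faceDir_of_combo hc ha hq (mul_pos hμ0 h0) hμκ.le ?_
  have e1 : (1 - μ * κ) • q = (μ * (1 - κ)) • b + (1 - μ) • (x₀ + (-t) • (y - x₀)) := by
    simp only [q, smul_add (1 - μ * κ), smul_smul (1 - μ * κ)]
    rw [mul_div_cancel₀ _ hsub.ne', mul_div_cancel₀ _ hsub.ne']
  have e2 : (1 - μ) * t = μ := by simp only [μ]; field_simp; ring
  have e3 : (1 - μ) • (x₀ + (-t) • (y - x₀)) = (1 - μ) • x₀ - μ • (y - x₀) := by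
    rw [smul_add, smul_smul, mul_neg, e2]; module
  rw [e1, e3, hyab]
  module

theorem faceDir_le (hc : Convex ℝ P) (hx₀ : x₀ ∈ P) {y : Space d}
    (hy : y - x₀ ∈ faceDir P x₀) : faceDir P y ≤ faceDir P x₀ := by
  refine Submodule.span_le.2 fun v hv => ?_
  have h := sub_mem_faceDir_of_mem_face hc hx₀ hy hv.1 hv.2 (κ := 1 / 2) (by norm_num) (by norm_num)
    (by module)
  have : v = (y + v - x₀) - (y - x₀) := by abel
  rw [this]
  exact Submodule.sub_mem _ h hy

/-- The part of the affine space `x₀ + V` outside `P`. -/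
def faceCompl (P : Set (Space d)) (V : Submodule ℝ (Space d)) (x₀ : Space d) : Set (Space d) :=
  {z | z - x₀ ∈ V ∧ z ∉ P}

/-- The distance to the boundary of `P` within the affine space `x₀ + V`. -/
noncomputable def faceDist (P : Set (Space d)) (V : Submodule ℝ (Space d)) (x₀ y : Space d) : ℝ :=
  Metric.infDist y (faceCompl P V x₀)

theorem faceDist_nonneg (y : Space d) : 0 ≤ faceDist P V x₀ y := Metric.infDist_nonneg

theorem faceCompl_nonempty (hP : Bornology.IsBounded P) (hV : V ≠ ⊥) :
    (faceCompl P V x₀).Nonempty := by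
  obtain ⟨v, hv, hv0⟩ := Submodule.exists_mem_ne_zero_of_ne_bot hV
  obtain ⟨R, hR⟩ := hP.exists_norm_le
  have hvn : 0 < ‖v‖ := norm_pos_iff.2 hv0
  refine ⟨x₀ + ((|R| + ‖x₀‖ + 1) / ‖v‖) • v, by simpa using V.smul_mem _ hv, fun hmem => ?_⟩
  have h1 := hR _ hmem
  have h2 := norm_sub_norm_le (((|R| + ‖x₀‖ + 1) / ‖v‖) • v) (-x₀)
  rw [norm_smul, Real.norm_of_nonneg (by positivity), div_mul_cancel₀ _ hvn.ne', norm_neg,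
    sub_neg_eq_add, add_comm _ x₀] at h2
  linarith [le_abs_self R]

theorem add_mem_of_norm_lt_faceDist {y v : Space d} (hy : y - x₀ ∈ V) (hv : v ∈ V)
    (h : ‖v‖ < faceDist P V x₀ y) : y + v ∈ P := by
  by_contra hn
  have hmem : y + v ∈ faceCompl P V x₀ := ⟨by rw [add_sub_right_comm]; exact V.add_mem hy hv, hn⟩
  have := Metric.infDist_le_dist_of_mem (x := y) hmem
  rw [dist_self_add_right] at this
  exact absurd h (not_lt.2 this)

theorem add_mem_of_norm_le_faceDist (hP : IsClosed P) {y v : Space d} (hyP : y ∈ P)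
    (hy : y - x₀ ∈ V) (hv : v ∈ V) (h : ‖v‖ ≤ faceDist P V x₀ y) : y + v ∈ P := by
  rcases eq_or_ne v 0 with rfl | hv0
  · simpa using hyP
  have hlim : Tendsto (fun t : ℝ => y + t • v) (𝓝[<] 1) (𝓝 (y + v)) := by
    have : Continuous fun t : ℝ => y + t • v := by fun_prop
    simpa using (this.tendsto 1).mono_left nhdsWithin_le_nhds
  refine hP.mem_of_tendsto hlim ?_
  filter_upwards [Ioo_mem_nhdsLT (zero_lt_one (α := ℝ))] with t ht
  refine add_mem_of_norm_lt_faceDist hy (V.smul_mem _ hv) ?_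
  rw [norm_smul, Real.norm_of_nonneg ht.1.le]
  have := norm_pos_iff.2 hv0
  nlinarith [ht.2]

theorem faceDist_le_add_norm (y z : Space d) :
    faceDist P V x₀ y ≤ faceDist P V x₀ z + ‖y - z‖ := by
  rw [← dist_eq_norm]; exact Metric.infDist_le_infDist_add_dist

theorem le_faceDist (hne : (faceCompl P V x₀).Nonempty) {y : Space d} (hy : y - x₀ ∈ V) {r : ℝ}
    (h : ∀ v ∈ V, ‖v‖ < r → y + v ∈ P) : r ≤ faceDist P V x₀ y := by
  refine (Metric.le_infDist hne).2 fun z hz => ?_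
  by_contra! hlt
  refine hz.2 ?_
  have hzy : z - y ∈ V := by
    have := V.sub_mem hz.1 hy
    rwa [sub_sub_sub_cancel_right] at this
  have := h (z - y) hzy (by rwa [← dist_eq_norm, dist_comm])
  rwa [add_sub_cancel] at this

theorem exists_closest (hP : IsClosed P) (hne : (faceCompl P V x₀).Nonempty) {y : Space d}
    (hyP : y ∈ P) (hy : y - x₀ ∈ V) :
    ∃ n ∈ V, ‖n‖ = faceDist P V x₀ y ∧ y + n ∈ P ∧ faceDist P V x₀ (y + n) = 0 := by
  obtain ⟨z, hz, hd⟩ := Metric.exists_mem_closure_infDist_eq_dist hne y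
  have hzV : z - x₀ ∈ V := by
    have hcl : IsClosed {w : Space d | w - x₀ ∈ V} :=
      V.closed_of_finiteDimensional.preimage (f := fun w => w - x₀) (by fun_prop)
    exact closure_minimal (fun w hw => hw.1) hcl hz
  have hn : z - y ∈ V := by
    have := V.sub_mem hzV hy
    rwa [sub_sub_sub_cancel_right] at this
  have hnorm : ‖z - y‖ = faceDist P V x₀ y := by
    rw [← dist_eq_norm, dist_comm]; exact hd.symm
  refine ⟨z - y, hn, hnorm, add_mem_of_norm_le_faceDist hP hyP hy hn hnorm.le, ?_⟩
  rw [add_sub_cancel]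
  exact (Metric.mem_closure_iff_infDist_zero hne).1 hz

/-- A convex combination of the balls inscribed at y and z is a ball in P whose radius is the
combination of the radii. -/
theorem concaveOn_faceDist (hc : Convex ℝ P) (hne : (faceCompl P V x₀).Nonempty) :
    ConcaveOn ℝ {y | y ∈ P ∧ y - x₀ ∈ V} (faceDist P V x₀) := by
  have hF : Convex ℝ {y | y ∈ P ∧ y - x₀ ∈ V} := by
    intro y hy z hz a b ha hb hab
    refine ⟨hc hy.1 hz.1 ha hb hab, ?_⟩
    have : a • y + b • z - x₀ = a • (y - x₀) + b • (z - x₀) := by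
      rw [show b = 1 - a by linarith]; module
    rw [this]
    exact V.add_mem (V.smul_mem _ hy.2) (V.smul_mem _ hz.2)
  refine ⟨hF, fun y hy z hz a b ha hb hab => ?_⟩
  simp only [smul_eq_mul]
  refine le_faceDist hne (hF hy hz ha hb hab).2 fun v hv hlt => ?_
  set R := a * faceDist P V x₀ y + b * faceDist P V x₀ z
  have hR : 0 < R := (norm_nonneg v).trans_lt hlt
  have key : ∀ w, w ∈ P → w - x₀ ∈ V → w + (faceDist P V x₀ w / R) • v ∈ P := by
    intro w hwP hw
    rcases (faceDist_nonneg (P := P) (V := V) (x₀ := x₀) w).eq_or_lt with h0 | hpos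
    · rw [← h0]; simpa using hwP
    · refine add_mem_of_norm_lt_faceDist hw (V.smul_mem _ hv) ?_
      rw [norm_smul, Real.norm_of_nonneg (by positivity), div_mul_eq_mul_div, div_lt_iff₀ hR]
      exact mul_lt_mul_of_pos_left hlt hpos
  have hcomb := hc (key y hy.1 hy.2) (key z hz.1 hz.2) ha hb hab
  have hone : a * (faceDist P V x₀ y / R) + b * (faceDist P V x₀ z / R) = 1 := by
    rw [← mul_div_assoc, ← mul_div_assoc, ← add_div]; exact div_self hR.ne'
  convert hcomb using 1
  rw [smul_add, smul_add, smul_smul, smul_smul, add_add_add_comm, ← add_smul, hone, one_smul]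

/-- The homothety with centre q and ratio κ maps the ball inscribed at y into P. -/
theorem mul_faceDist_le (hc : Convex ℝ P) (hne : (faceCompl P V x₀).Nonempty) {y z q : Space d}
    (hy : y - x₀ ∈ V) (hz : z - x₀ ∈ V) (hq : q ∈ P) {κ : ℝ} (h0 : 0 < κ) (h1 : κ ≤ 1)
    (hzy : z = κ • y + (1 - κ) • q) : κ * faceDist P V x₀ y ≤ faceDist P V x₀ z := by
  refine le_faceDist hne hz fun v hv hlt => ?_
  have h := add_mem_of_norm_lt_faceDist (P := P) hy (V.smul_mem κ⁻¹ hv) (by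
    rw [norm_smul, norm_inv, Real.norm_of_nonneg h0.le, inv_mul_lt_iff₀ h0]; exact hlt)
  have := hc h hq h0.le (by linarith : (0 : ℝ) ≤ 1 - κ) (by ring)
  convert this using 1
  rw [hzy, smul_add, smul_smul, mul_inv_cancel₀ h0.ne', one_smul]
  abel

theorem faceDir_eq_of_faceDist_pos (hc : Convex ℝ P) (hx₀ : x₀ ∈ P) {y : Space d}
    (hy : y - x₀ ∈ faceDir P x₀) (h : 0 < faceDist P (faceDir P x₀) x₀ y) :
    faceDir P y = faceDir P x₀ := by
  refine le_antisymm (faceDir_le hc hx₀ hy) fun v hv => ?_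
  set D := faceDist P (faceDir P x₀) x₀ y
  set t := D / 2 / (‖v‖ + 1)
  have ht : 0 < t := by positivity
  have hlt : ‖t • v‖ < D := by
    rw [norm_smul, Real.norm_of_nonneg ht.le, div_mul_eq_mul_div, div_lt_iff₀ (by positivity)]
    nlinarith [norm_nonneg v]
  have hmem : t • v ∈ faceDir P y := by
    refine Submodule.subset_span ⟨?_, ?_⟩
    · exact add_mem_of_norm_lt_faceDist hy (Submodule.smul_mem _ _ hv) hlt
    · rw [sub_eq_add_neg]
      exact add_mem_of_norm_lt_faceDist hy
        (Submodule.neg_mem _ (Submodule.smul_mem _ _ hv)) (by rwa [norm_neg])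
  simpa [smul_smul, inv_mul_cancel₀ ht.ne'] using (faceDir P y).smul_mem t⁻¹ hmem

theorem finrank_faceDir_lt (hc : Convex ℝ P)
    (hne : (faceCompl P (faceDir P x₀) x₀).Nonempty) (hx₀ : x₀ ∈ P) {y : Space d} (hyP : y ∈ P)
    (hy : y - x₀ ∈ faceDir P x₀) (h : faceDist P (faceDir P x₀) x₀ y = 0) :
    Module.finrank ℝ (faceDir P y) < Module.finrank ℝ (faceDir P x₀) := by
  refine Submodule.finrank_lt_finrank_of_lt (lt_of_le_of_ne (faceDir_le hc hx₀ hy) fun heq => ?_)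
  obtain ⟨r, hr, hball⟩ := exists_ball_faceDir hc hyP
  have := le_faceDist hne hy (r := r) fun v hv hlt => hball v (heq ▸ hv) hlt.le
  linarith

theorem exists_unit_mem (hV : V ≠ ⊥) : ∃ v ∈ V, ‖v‖ = 1 := by
  obtain ⟨v, hv, hv0⟩ := Submodule.exists_mem_ne_zero_of_ne_bot hV
  exact ⟨‖v‖⁻¹ • v, V.smul_mem _ hv, norm_smul_inv_norm hv0⟩

theorem stepSize_eq (hc : Convex ℝ P) (hP : IsClosed P) (hne : (faceCompl P V x₀).Nonempty)
    {x : Space d} (hxP : x ∈ P) (hx : x - x₀ ∈ V) (hV : faceDir P x = V)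
    (h : 0 < faceDist P V x₀ x) {δ : ℝ} (hδ : 0 < δ) :
    stepSize P δ x = min δ (faceDist P V x₀ x) := by
  refine IsGreatest.csSup_eq ⟨⟨lt_min hδ h, min_le_left _ _, fun v hv hv1 => ?_⟩, ?_⟩
  · rw [hV] at hv
    have hn : ‖min δ (faceDist P V x₀ x) • v‖ ≤ faceDist P V x₀ x := by
      rw [norm_smul, hv1, mul_one, Real.norm_of_nonneg (lt_min hδ h).le]
      exact min_le_right _ _
    refine ⟨add_mem_of_norm_le_faceDist hP hxP hx (V.smul_mem _ hv) hn, ?_⟩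
    rw [sub_eq_add_neg]
    exact add_mem_of_norm_le_faceDist hP hxP hx (V.neg_mem (V.smul_mem _ hv)) (by rwa [norm_neg])
  · rintro r ⟨hr0, hrδ, hr⟩
    refine le_min hrδ (le_faceDist hne hx fun v hv hlt => ?_)
    rcases eq_or_ne v 0 with rfl | hv0
    · simpa using hxP
    have hvn := norm_pos_iff.2 hv0
    have h1 := (hr (‖v‖⁻¹ • v) (by rw [hV]; exact V.smul_mem _ hv) (norm_smul_inv_norm hv0)).1
    have hle : ‖v‖ / r ≤ 1 := (div_le_one hr0).2 hlt.le
    have := hc hxP h1 (by linarith : 0 ≤ 1 - ‖v‖ / r) (by positivity : 0 ≤ ‖v‖ / r) (by ring)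
    convert this using 1
    rw [smul_add, ← add_assoc, ← add_smul, sub_add_cancel, one_smul, smul_smul, smul_smul]
    rw [show ‖v‖ / r * r * ‖v‖⁻¹ = 1 by field_simp, one_smul]

end Faces

/-! ### Nodes, nodal hat functions and their distance to the boundary -/

section Mesh

variable {K : Geometry.SimplicialComplex ℝ (Space d)} {P : Set (Space d)} {σ h : ℝ}

theorem IsMesh.exists_element (hK : IsMesh K P σ h) {y : Space d} (hy : y ∈ P) :
    ∃ T ∈ elements K, y ∈ convexHull ℝ (T : Set (Space d)) := by
  rw [← hK.space_eq, Geometry.SimplicialComplex.mem_space_iff] at hy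
  obtain ⟨s, hs, hys⟩ := hy
  obtain ⟨T, hT, hsT⟩ := hK.pure s hs
  exact ⟨T, hT, convexHull_mono (by exact_mod_cast hsT) hys⟩

theorem IsMesh.convexHull_subset (hK : IsMesh K P σ h) {T : Finset (Space d)}
    (hT : T ∈ elements K) : convexHull ℝ (T : Set (Space d)) ⊆ P :=
  hK.space_eq ▸ Geometry.SimplicialComplex.convexHull_subset_space hT.1

theorem mem_vertices_of_mem_element {T : Finset (Space d)} (hT : T ∈ elements K) {z : Space d}
    (hz : z ∈ T) : z ∈ K.vertices :=
  K.down_closed hT.1 (Finset.singleton_subset_iff.2 hz) (Finset.singleton_nonempty z)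

theorem IsMesh.vertices_subset (hK : IsMesh K P σ h) : K.vertices ⊆ P := by
  intro z hz
  rw [← hK.space_eq]
  exact Geometry.SimplicialComplex.subset_space hz (by simp)

theorem IsMesh.finite_vertices (hK : IsMesh K P σ h) : K.vertices.Finite :=
  (hK.finite.preimage (Finset.singleton_injective.injOn)).subset fun _ hz => hz

theorem map_sum_affine (l : Space d →ᵃ[ℝ] ℝ) {T : Finset (Space d)} {c : Space d → ℝ}
    (h1 : ∑ z ∈ T, c z = 1) : l (∑ z ∈ T, c z • z) = ∑ z ∈ T, c z * l z := by
  have hdec : ∀ z, l z = l.linear z + l 0 := fun z => congrFun l.decomp z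
  rw [hdec, map_sum]
  simp_rw [map_smul, smul_eq_mul]
  calc _ = ∑ z ∈ T, c z * l.linear z + ∑ z ∈ T, c z * l 0 := by rw [← Finset.sum_mul, h1, one_mul]
    _ = _ := by
      rw [← Finset.sum_add_distrib]
      exact Finset.sum_congr rfl fun z _ => by rw [hdec z]; ring

/-- Each point of the domain is a convex combination of nodes at distance at most `h`, and the
piecewise linear functions are evaluated there by this combination. -/
theorem IsMesh.exists_combo (hK : IsMesh K P σ h) {y : Space d} (hy : y ∈ P) :
    ∃ (T : Finset (Space d)) (c : Space d → ℝ), (∀ z ∈ T, z ∈ K.vertices) ∧ (∀ z ∈ T, 0 < c z) ∧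
      ∑ z ∈ T, c z = 1 ∧ ∑ z ∈ T, c z • z = y ∧ (∀ z ∈ T, ‖z - y‖ ≤ h) ∧
      ∀ w, IsPiecewiseLinear K w → w y = ∑ z ∈ T, c z * w z := by
  classical
  obtain ⟨T, hT, hyT⟩ := hK.exists_element hy
  obtain ⟨c, hc, hc1, hcy⟩ := Finset.mem_convexHull'.1 hyT
  have hfilt : ∀ {F : Type} [AddCommMonoid F] (φ : Space d → F), (∀ z ∈ T, c z = 0 → φ z = 0) →
      ∑ z ∈ T with c z ≠ 0, φ z = ∑ z ∈ T, φ z := fun φ hφ =>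
    Finset.sum_filter_of_ne fun z hz hne h0 => hne (hφ z hz h0)
  have hmem : ∀ z ∈ T, z ∈ convexHull ℝ (T : Set (Space d)) := fun z hz =>
    subset_convexHull ℝ _ hz
  have hbdd : Bornology.IsBounded (convexHull ℝ (T : Set (Space d))) :=
    (T.finite_toSet.isCompact_convexHull ℝ).isBounded
  refine ⟨T.filter fun z => c z ≠ 0, c, fun z hz => ?_, fun z hz => ?_, ?_, ?_, fun z hz => ?_,
    fun w hw => ?_⟩
  · exact mem_vertices_of_mem_element hT (Finset.mem_filter.1 hz).1
  · exact (hc z (Finset.mem_filter.1 hz).1).lt_of_ne' (Finset.mem_filter.1 hz).2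
  · rw [hfilt c fun z _ h0 => h0, hc1]
  · rw [hfilt _ fun z _ h0 => by rw [h0, zero_smul], hcy]
  · rw [← dist_eq_norm]
    exact (Metric.dist_le_diam_of_mem hbdd (hmem z (Finset.mem_filter.1 hz).1) hyT).trans
      (hK.diam_le T hT)
  · rw [hfilt _ fun z _ h0 => by rw [h0, zero_mul]]
    obtain ⟨l, hl⟩ := hw.2 T hT
    rw [hl hyT, ← hcy, map_sum_affine l hc1]
    exact Finset.sum_congr rfl fun z hz => by rw [hl (hmem z hz)]

/-- The affine function that is `1` at the node `x` and `0` at the other vertices of an element. -/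
theorem exists_affine_hat {T : Finset (Space d)} (hT : T ∈ elements K) (x : Space d) :
    ∃ b : Space d →ᵃ[ℝ] ℝ, ∀ z ∈ T, b z = if z = x then 1 else 0 := by
  classical
  by_cases hx : x ∈ T
  · have hind := K.indep hT.1
    have htop : affineSpan ℝ (Set.range ((↑) : T → Space d)) = ⊤ := by
      rw [hind.affineSpan_eq_top_iff_card_eq_finrank_add_one]
      simpa using hT.2
    let B : AffineBasis T ℝ (Space d) := ⟨_, hind, htop⟩
    refine ⟨B.coord ⟨x, hx⟩, fun z hz => ?_⟩
    have h1 : z = B ⟨z, hz⟩ := rfl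
    conv_lhs => rw [h1]
    rw [B.coord_apply]
    simp [eq_comm]
  · exact ⟨0, fun z hz => by rw [if_neg (by rintro rfl; exact hx hz)]; rfl⟩

/-- The hat varies by at most 1 across an inscribed ball of diameter 2r, so its slope is at most
1/(2r), and h ≤ σ h_T ≤ σ²(2r). -/
theorem IsMesh.affine_hat_lipschitz (hK : IsMesh K P σ h) (hh : 0 < h) (hσ : 0 < σ)
    {T : Finset (Space d)} (hT : T ∈ elements K) {x : Space d} {b : Space d →ᵃ[ℝ] ℝ}
    (hb : ∀ z ∈ T, b z = if z = x then 1 else 0) (y z : Space d) :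
    |b y - b z| ≤ σ ^ 2 / h * ‖y - z‖ := by
  have hrange : ∀ w ∈ convexHull ℝ (T : Set (Space d)), 0 ≤ b w ∧ b w ≤ 1 := by
    intro w hw
    obtain ⟨c, hc, hc1, hcw⟩ := Finset.mem_convexHull'.1 hw
    rw [← hcw, map_sum_affine b hc1]
    have h01 : ∀ z ∈ T, 0 ≤ b z ∧ b z ≤ 1 := fun z hz => by rw [hb z hz]; split_ifs <;> norm_num
    refine ⟨Finset.sum_nonneg fun z hz => mul_nonneg (hc z hz) (h01 z hz).1, ?_⟩
    rw [← hc1]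
    exact Finset.sum_le_sum fun z hz => mul_le_of_le_one_right (hc z hz) (h01 z hz).2
  obtain ⟨c, r, hr, hball, hdiam⟩ := hK.shape_regular T hT
  have hqu := hK.quasi_uniform T hT
  have h2r : h ≤ σ ^ 2 * (2 * r) := by nlinarith
  have hlin : b y - b z = b.linear (y - z) := (b.linearMap_vsub y z).symm
  rw [hlin]
  rcases eq_or_ne (y - z) 0 with h0 | h0
  · simp [h0]
  have hn := norm_pos_iff.2 h0
  set v := (r / ‖y - z‖) • (y - z)
  have hv : ‖v‖ = r := by
    rw [norm_smul, Real.norm_of_nonneg (by positivity), div_mul_cancel₀ _ hn.ne']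
  have h1 := hrange _ (hball (show c + v ∈ Metric.closedBall c r by simp [hv]))
  have h2 := hrange _ (hball (show c - v ∈ Metric.closedBall c r by simp [hv]))
  have hd : b (c + v) - b (c - v) = 2 * (r / ‖y - z‖) * b.linear (y - z) := by
    have : b (c + v) - b (c - v) = b.linear ((c + v) - (c - v)) :=
      (b.linearMap_vsub (c + v) (c - v)).symm
    rw [this, show (c + v) - (c - v) = (2 : ℝ) • v by module, map_smul, map_smul, smul_eq_mul,
      smul_eq_mul, mul_assoc]
  have habs : |2 * (r / ‖y - z‖) * b.linear (y - z)| ≤ 1 := by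
    rw [← hd, abs_le]; constructor <;> linarith [h1.1, h1.2, h2.1, h2.2]
  rw [abs_mul, abs_of_pos (by positivity)] at habs
  have h3 : 2 * r * |b.linear (y - z)| ≤ ‖y - z‖ := by
    rw [mul_div_assoc', div_mul_eq_mul_div, div_le_one hn] at habs
    exact habs
  rw [div_mul_eq_mul_div, le_div_iff₀ hh]
  calc |b.linear (y - z)| * h ≤ |b.linear (y - z)| * (σ ^ 2 * (2 * r)) :=
        mul_le_mul_of_nonneg_left h2r (abs_nonneg _)
    _ = σ ^ 2 * (2 * r * |b.linear (y - z)|) := by ring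
    _ ≤ σ ^ 2 * ‖y - z‖ := mul_le_mul_of_nonneg_left h3 (by positivity)

theorem eqOn_inter_of_eqOn_vertices {T T' : Finset (Space d)} (hT : T ∈ elements K)
    (hT' : T' ∈ elements K) {x : Space d} {b b' : Space d →ᵃ[ℝ] ℝ}
    (hb : ∀ z ∈ T, b z = if z = x then 1 else 0) (hb' : ∀ z ∈ T', b' z = if z = x then 1 else 0)
    {y : Space d} (hy : y ∈ convexHull ℝ (T : Set (Space d)))
    (hy' : y ∈ convexHull ℝ (T' : Set (Space d))) : b y = b' y := by
  classical
  have h := K.inter_subset_convexHull hT.1 hT'.1 ⟨hy, hy'⟩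
  rw [← Finset.coe_inter] at h
  obtain ⟨c, -, hc1, rfl⟩ := Finset.mem_convexHull'.1 h
  rw [map_sum_affine b hc1, map_sum_affine b' hc1]
  refine Finset.sum_congr rfl fun z hz => ?_
  rw [hb z (Finset.mem_inter.1 hz).1, hb' z (Finset.mem_inter.1 hz).2]

/-- A function on the real line which is, on each set of a finite closed cover of an interval,
Lipschitz, has the Lipschitz bound on the whole interval. -/
theorem le_of_finite_closed_cover {ι : Type*} {I : Set ι} (hI : I.Finite) {A : ι → Set ℝ}
    (hA : ∀ i ∈ I, IsClosed (A i)) (hcov : ∀ t ∈ Set.Icc (0 : ℝ) 1, ∃ i ∈ I, t ∈ A i) {φ : ℝ → ℝ}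
    {C : ℝ} (hC : 0 ≤ C) (hφ : ∀ i ∈ I, ∀ t ∈ A i, ∀ t' ∈ A i, |φ t - φ t'| ≤ C * |t - t'|) :
    φ 0 - C ≤ φ 1 := by
  have hcont : ContinuousOn φ (Set.Icc 0 1) := by
    have : Finite I := hI
    have h1 : ContinuousOn φ (⋃ i : I, A i) := by
      refine LocallyFinite.continuousOn_iUnion (locallyFinite_of_finite _)
        (fun i => hA i i.2) fun i => ?_
      have : LipschitzOnWith ⟨C, hC⟩ φ (A i) :=
        LipschitzOnWith.of_dist_le_mul fun t ht t' ht' => by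
          rw [Real.dist_eq, Real.dist_eq]; exact hφ i i.2 t ht t' ht'
      exact this.continuousOn
    refine h1.mono fun t ht => ?_
    obtain ⟨i, hi, hti⟩ := hcov t ht
    exact Set.mem_iUnion.2 ⟨⟨i, hi⟩, hti⟩
  have key := image_le_of_liminf_slope_right_le_deriv_boundary (f := fun t => -φ t) (a := 0) (b := 1)
    (B := fun t => -φ 0 + C * t) (B' := fun _ => C) hcont.neg (by simp) (by fun_prop)
    (fun t _ => by
      simpa using ((hasDerivWithinAt_id t (Set.Ici t)).const_mul C).const_add (-φ 0))
    (fun t ht r hr => by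
      -- As the cover is finite, one member accumulates at t from the right, and being closed it
      -- contains t; its Lipschitz bound controls the lower right slope.
      have hfreq : ∃ i ∈ I, ∃ᶠ t' in 𝓝[>] t, t' ∈ A i := by
        by_contra! hno
        have hall : ∀ᶠ t' in 𝓝[>] t, ∀ i ∈ I, t' ∉ A i := by
          rw [hI.eventually_all]
          exact fun i hi => hno i hi
        have hmem : ∀ᶠ t' in 𝓝[>] t, t' ∈ Set.Icc (0 : ℝ) 1 := by
          filter_upwards [Ioo_mem_nhdsGT ht.2] with t' ht'
          exact ⟨ht.1.trans ht'.1.le, ht'.2.le⟩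
        obtain ⟨t', h1, h2⟩ := (hall.and hmem).exists
        obtain ⟨i, hi, hti⟩ := hcov t' h2
        exact h1 i hi hti
      obtain ⟨i, hi, hfr⟩ := hfreq
      have htA : t ∈ A i := (hA i hi).mem_of_frequently_of_tendsto hfr
        (tendsto_id.mono_left nhdsWithin_le_nhds)
      refine (hfr.and_eventually self_mem_nhdsWithin).mono fun t' ht' => ?_
      have hlt : 0 < t' - t := sub_pos.2 ht'.2
      have hb := hφ i hi t htA t' ht'.1
      rw [slope_def_field]
      refine lt_of_le_of_lt ?_ hr
      rw [div_le_iff₀ hlt]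
      rw [abs_sub_comm t, abs_of_pos hlt] at hb
      linarith [(abs_le.1 hb).2])
  have := key (Set.right_mem_Icc.2 zero_le_one)
  simp only [mul_one] at this
  linarith

/-- A point close to a node lies in the open star of this node. -/
theorem IsMesh.exists_combo_of_close (hK : IsMesh K P σ h) (hc : Convex ℝ P) (hh : 0 < h)
    (hσ : 0 < σ) {x z : Space d} (hx : x ∈ K.vertices) (hz : z ∈ P)
    (hclose : σ ^ 2 / h * ‖z - x‖ < 1) :
    ∃ q ∈ P, ∃ κ : ℝ, 0 < κ ∧ κ ≤ 1 ∧ z = κ • x + (1 - κ) • q := by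
  classical
  have hxP := hK.vertices_subset hx
  choose! b hb using fun (T : Finset (Space d)) (hT : T ∈ elements K) => exists_affine_hat hT x
  choose! τ hτ hyτ using fun (y : Space d) (hy : y ∈ P) => hK.exists_element hy
  set γ : ℝ → Space d := fun t => x + t • (z - x)
  have hγ : ∀ t ∈ Set.Icc (0 : ℝ) 1, γ t ∈ P := fun t ht => by
    have : γ t = (1 - t) • x + t • z := by simp only [γ]; module
    rw [this]
    exact hc hxP hz (by linarith [ht.2]) ht.1 (by ring)
  have hφ : ∀ T ∈ elements K, ∀ y ∈ convexHull ℝ (T : Set (Space d)), b (τ y) y = b T y :=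
    fun T hT y hy => by
      have hyP := hK.convexHull_subset hT hy
      exact eqOn_inter_of_eqOn_vertices (hτ y hyP) hT (hb _ (hτ y hyP)) (hb T hT) (hyτ y hyP) hy
  -- Along the segment the hat function of x starts at 1 and falls by less than 1. So it is positive
  -- at z, and x is a vertex, with positive weight, of an element containing z.
  have hbound := le_of_finite_closed_cover (I := elements K) (hK.finite.subset fun T hT => hT.1)
    (A := fun T => γ ⁻¹' convexHull ℝ (T : Set (Space d)))
    (fun T _ => (T.finite_toSet.isCompact_convexHull ℝ).isClosed.preimage (by fun_prop))
    (fun t ht => ⟨_, hτ _ (hγ t ht), hyτ _ (hγ t ht)⟩) (φ := fun t => b (τ (γ t)) (γ t))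
    (C := σ ^ 2 / h * ‖z - x‖) (by positivity) (fun T hT t ht t' ht' => by
      rw [hφ T hT _ ht, hφ T hT _ ht']
      refine (hK.affine_hat_lipschitz hh hσ hT (hb T hT) _ _).trans (le_of_eq ?_)
      have : γ t - γ t' = (t - t') • (z - x) := by simp only [γ]; module
      rw [this, norm_smul, Real.norm_eq_abs]; ring)
  have hγ0 : γ 0 = x := by simp [γ]
  have hγ1 : γ 1 = z := by simp [γ]
  simp only [hγ0, hγ1] at hbound
  obtain ⟨T₀, hT₀, hxT₀⟩ := hK.pure _ hx
  have hxT₀' : x ∈ T₀ := Finset.singleton_subset_iff.1 hxT₀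
  rw [hφ T₀ hT₀ x (subset_convexHull ℝ _ hxT₀'), hb T₀ hT₀ x hxT₀', if_pos rfl] at hbound
  have hpos : 0 < b (τ z) z := by linarith
  set T := τ z
  have hT : T ∈ elements K := hτ z hz
  obtain ⟨c, hc0, hc1, hcz⟩ := Finset.mem_convexHull'.1 (hyτ z hz)
  have hbz : b T z = ∑ w ∈ T, c w * if w = x then 1 else 0 := by
    conv_lhs => rw [← hcz]
    rw [map_sum_affine _ hc1]
    exact Finset.sum_congr rfl fun w hw => by rw [hb T hT w hw]
  simp only [mul_ite, mul_one, mul_zero, Finset.sum_ite_eq'] at hbz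
  by_cases hxT : x ∈ T
  swap
  · rw [if_neg hxT] at hbz; linarith
  rw [if_pos hxT] at hbz
  obtain ⟨hle, q, hq, hsum⟩ := exists_rest_of_combo hc hc0 hc1
    (fun w hw => hK.convexHull_subset hT (subset_convexHull ℝ _ hw)) hxT
  exact ⟨q, hq, c x, by linarith, hle, hcz ▸ hsum⟩

/-- The distance of a node to the relative boundary of a face is zero or at least a fixed multiple of
the mesh size. -/
theorem IsMesh.le_faceDist (hK : IsMesh K P σ h) (hP : IsClosed P) (hc : Convex ℝ P) (hh : 0 < h)
    (hσ : 0 < σ) {V : Submodule ℝ (Space d)} {x₀ : Space d} (hne : (faceCompl P V x₀).Nonempty)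
    {x : Space d} (hx : x ∈ K.vertices) (hxV : x - x₀ ∈ V) (hpos : 0 < faceDist P V x₀ x) :
    h / σ ^ 2 ≤ faceDist P V x₀ x := by
  obtain ⟨n, hn, hnorm, hnP, hn0⟩ := exists_closest hP hne (hK.vertices_subset hx) hxV
  by_contra! hlt
  obtain ⟨q, hq, κ, hκ0, hκ1, hcombo⟩ := hK.exists_combo_of_close hc hh hσ hx hnP (by
    rw [add_sub_cancel_left, hnorm, div_mul_eq_mul_div, div_lt_one hh, mul_comm]
    exact (lt_div_iff₀ (by positivity)).1 hlt)
  -- The closest boundary point would have positive weight on x, hence positive distance to the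
  -- relative boundary.
  have := mul_faceDist_le hc hne hxV
    (by rw [add_sub_right_comm]; exact V.add_mem hxV hn) hq hκ0 hκ1 hcombo
  rw [hn0] at this
  nlinarith

end Mesh

/-! ### The boundary layer barrier -/

section Barrier

theorem exists_rpow_gap {β N : ℝ} (hβ : 0 < β) (hβ1 : β < 1) (hN : 1 ≤ N) :
    ∃ c > 0, ∃ θ₀ > 0, θ₀ ≤ 1 ∧ ∀ q, 1 / N ≤ q → q ≤ 1 → ∀ θ, 0 ≤ θ → θ ≤ θ₀ →
      c ≤ 2 - (1 - q + θ * q) ^ β - (1 + q) ^ β := by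
  have hsc := Real.strictConcaveOn_rpow hβ hβ1
  have hmid : ∀ q : ℝ, 0 < q → q ≤ 1 → 0 < 2 - (1 - q) ^ β - (1 + q) ^ β := fun q hq hq1 => by
    have h := hsc.2 (show 1 - q ∈ Set.Ici (0 : ℝ) by simp [hq1])
      (show 1 + q ∈ Set.Ici (0 : ℝ) by simp; linarith) (by intro h; linarith)
      (by norm_num : (0 : ℝ) < 1 / 2) (by norm_num : (0 : ℝ) < 1 / 2) (by norm_num)
    simp only [smul_eq_mul] at h
    rw [show 1 / 2 * (1 - q) + 1 / 2 * (1 + q) = (1 : ℝ) by ring, Real.one_rpow] at h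
    linarith
  set q₀ := 1 / N
  have hq₀ : 0 < q₀ := by positivity
  have hq₀1 : q₀ ≤ 1 := (div_le_one (by linarith)).2 hN
  set H := 2 - (1 - q₀) ^ β - (1 + q₀) ^ β
  have hH : 0 < H := hmid q₀ hq₀ hq₀1
  refine ⟨H / 2, by positivity, min 1 ((H / 2) ^ (1 / β)), by positivity, min_le_left _ _,
    fun q hq hq1 θ hθ hθ₀ => ?_⟩
  have hq0 : 0 < q := hq₀.trans_le hq
  -- The gap is convex in q and vanishes at q = 0, so it is smallest at q₀.
  have hmono : H ≤ 2 - (1 - q) ^ β - (1 + q) ^ β := by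
    set p := q₀ / q
    have hp0 : 0 < p := by positivity
    have hp1 : p ≤ 1 := (div_le_one hq0).2 hq
    have hpq : p * q = q₀ := div_mul_cancel₀ _ hq0.ne'
    have hcv := hsc.concaveOn.2
    have h1 := hcv (show (1 : ℝ) ∈ Set.Ici (0 : ℝ) by simp)
      (show 1 - q ∈ Set.Ici (0 : ℝ) by simp [hq1]) (by linarith : 0 ≤ 1 - p) hp0.le (by ring)
    have h2 := hcv (show (1 : ℝ) ∈ Set.Ici (0 : ℝ) by simp)
      (show 1 + q ∈ Set.Ici (0 : ℝ) by simp; linarith) (by linarith : 0 ≤ 1 - p) hp0.le (by ring)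
    simp only [smul_eq_mul, Real.one_rpow] at h1 h2
    rw [show (1 - p) * 1 + p * (1 - q) = 1 - q₀ by linarith] at h1
    rw [show (1 - p) * 1 + p * (1 + q) = 1 + q₀ by linarith] at h2
    have h3 := hmid q hq0 hq1
    have : H ≤ p * (2 - (1 - q) ^ β - (1 + q) ^ β) := by simp only [H]; linarith
    nlinarith
  -- Subadditivity of the power bounds the cost of the shift by (θq)^β, at most half of the gap.
  have hsub := Real.rpow_add_le_add_rpow (by linarith : 0 ≤ 1 - q) (by positivity : 0 ≤ θ * q)
    hβ.le hβ1.le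
  have hθq : (θ * q) ^ β ≤ H / 2 := by
    calc (θ * q) ^ β ≤ ((H / 2) ^ (1 / β)) ^ β := by
          refine Real.rpow_le_rpow (by positivity) ?_ hβ.le
          exact (mul_le_of_le_one_right hθ hq1).trans (hθ₀.trans (min_le_right _ _))
      _ = H / 2 := by
          rw [← Real.rpow_mul (by positivity), one_div_mul_cancel hβ.ne', Real.rpow_one]
  linarith

/-- A concave function of the distance to the boundary whose second differences are very negative in
a boundary layer, also if the inner point is slightly shifted. -/
theorem exists_barrier {s N : ℝ} (hs : 0 < s) (hs2 : s ≤ 2) (hN : 1 ≤ N) :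
    ∃ B ≥ 0, ∃ c > 0, ∃ θ₀ > 0, θ₀ ≤ 1 ∧ ∀ δ > 0, ∃ g : ℝ → ℝ,
      ConcaveOn ℝ (Set.Ici 0) g ∧ MonotoneOn g (Set.Ici 0) ∧ (∀ t, 0 ≤ t → 0 ≤ g t) ∧
      (∀ t, 0 ≤ t → g t ≤ B * δ ^ s) ∧
      ∀ t, 0 < t → t ≤ N * δ → ∀ θ, 0 ≤ θ → θ ≤ θ₀ →
        c * min δ t ^ s ≤ 2 * g t - g (t - min δ t + θ * min δ t) - g (t + min δ t) := by
  -- Any exponent below 1 and at most s would do: strict concavity needs β < 1, and comparing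
  -- (r/δ)^s with (r/δ)^β needs β ≤ s.
  set β := s / 4
  have hβ : 0 < β := by positivity
  have hβ1 : β < 1 := by simp only [β]; linarith
  have hβs : β ≤ s := by simp only [β]; linarith
  obtain ⟨c, hc, θ₀, hθ₀, hθ₀1, hgap⟩ := exists_rpow_gap hβ hβ1 hN
  refine ⟨(N + 1) ^ β, by positivity, c, hc, θ₀, hθ₀, hθ₀1, fun δ hδ => ?_⟩
  -- Truncation keeps g of size δ^s and is inactive at t ≤ Nδ; at the neighbours it can only lower
  -- g, which helps.
  set m : ℝ → ℝ := fun t => min (t / δ) (N + 1)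
  have hm0 : ∀ t, 0 ≤ t → 0 ≤ m t := fun t ht => le_min (by positivity) (by linarith)
  have hmmono : Monotone m := fun t t' h =>
    min_le_min_right _ (div_le_div_of_nonneg_right h hδ.le)
  have hδs : 0 < δ ^ s := Real.rpow_pos_of_pos hδ s
  have hconc := Real.concaveOn_rpow hβ.le hβ1.le
  refine ⟨fun t => δ ^ s * m t ^ β, ⟨convex_Ici 0, fun x hx y hy a b ha hb hab => ?_⟩,
    fun x hx y hy hxy => ?_, fun t ht => ?_, fun t ht => ?_, fun t ht htN θ hθ hθ' => ?_⟩
  · simp only [Set.mem_Ici, smul_eq_mul] at hx hy ⊢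
    have h1 := hconc.2 (show m x ∈ Set.Ici (0 : ℝ) from hm0 x hx)
      (show m y ∈ Set.Ici (0 : ℝ) from hm0 y hy) ha hb hab
    simp only [smul_eq_mul] at h1
    have h2 : a * m x + b * m y ≤ m (a * x + b * y) := by
      refine le_min ?_ ?_
      · have e1 : m x ≤ x / δ := min_le_left _ _
        have e2 : m y ≤ y / δ := min_le_left _ _
        calc a * m x + b * m y ≤ a * (x / δ) + b * (y / δ) := by gcongr
          _ = (a * x + b * y) / δ := by ring
      · have e1 : m x ≤ N + 1 := min_le_right _ _
        have e2 : m y ≤ N + 1 := min_le_right _ _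
        calc a * m x + b * m y ≤ a * (N + 1) + b * (N + 1) := by gcongr
          _ = N + 1 := by rw [← add_mul, hab, one_mul]
    have h3 : (a * m x + b * m y) ^ β ≤ m (a * x + b * y) ^ β :=
      Real.rpow_le_rpow (add_nonneg (mul_nonneg ha (hm0 x hx)) (mul_nonneg hb (hm0 y hy))) h2 hβ.le
    nlinarith [mul_le_mul_of_nonneg_left (h1.trans h3) hδs.le]
  · exact mul_le_mul_of_nonneg_left (Real.rpow_le_rpow (hm0 x hx) (hmmono hxy) hβ.le) hδs.le
  · exact mul_nonneg hδs.le (Real.rpow_nonneg (hm0 t ht) _)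
  · rw [mul_comm (_ ^ β)]
    exact mul_le_mul_of_nonneg_left (Real.rpow_le_rpow (hm0 t ht) (min_le_right _ _) hβ.le) hδs.le
  · set r := min δ t
    have hr : 0 < r := lt_min hδ ht
    have hrt : r ≤ t := min_le_right _ _
    have hrδ : r ≤ δ := min_le_left _ _
    set q := r / t
    have hq1 : q ≤ 1 := (div_le_one ht).2 hrt
    have hqN : 1 / N ≤ q := by
      rw [div_le_div_iff₀ (by linarith) ht, one_mul]
      rcases min_cases δ t with ⟨h1, _⟩ | ⟨h1, _⟩
      · simp only [r, h1]; linarith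
      · simp only [r, h1]; nlinarith
    have hqt : q * t = r := div_mul_cancel₀ _ ht.ne'
    have hτ : 0 < t / δ := by positivity
    have hmt : m t = t / δ := min_eq_left (by rw [div_le_iff₀ hδ]; linarith)
    have hle : ∀ p, 0 ≤ p → m (p * t) ^ β ≤ p ^ β * (t / δ) ^ β := fun p hp => by
      rw [← Real.mul_rpow hp hτ.le]
      refine Real.rpow_le_rpow (hm0 _ (by positivity)) ((min_le_left _ _).trans (le_of_eq ?_)) hβ.le
      ring
    have hθq : 0 ≤ θ * q := by positivity
    have e1 := hle (1 - q + θ * q) (by linarith)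
    have e2 := hle (1 + q) (by positivity)
    rw [show (1 - q + θ * q) * t = t - r + θ * r by rw [← hqt]; ring] at e1
    rw [show (1 + q) * t = t + r by rw [← hqt]; ring] at e2
    have hg := hgap q hqN hq1 θ hθ hθ'
    have hτβ : 0 < (t / δ) ^ β := Real.rpow_pos_of_pos hτ β
    have key : c * (t / δ) ^ β ≤
        2 * m t ^ β - m (t - r + θ * r) ^ β - m (t + r) ^ β := by
      rw [hmt]
      nlinarith [mul_le_mul_of_nonneg_right hg hτβ.le]
    have hrs : r ^ s ≤ δ ^ s * (t / δ) ^ β := by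
      calc r ^ s = δ ^ s * (r / δ) ^ s := by
            rw [← Real.mul_rpow hδ.le (by positivity), mul_div_cancel₀ _ hδ.ne']
        _ ≤ δ ^ s * (r / δ) ^ β := mul_le_mul_of_nonneg_left
            (Real.rpow_le_rpow_of_exponent_ge (by positivity) ((div_le_one hδ).2 hrδ) hβs) hδs.le
        _ ≤ δ ^ s * (t / δ) ^ β := by gcongr
    nlinarith [mul_le_mul_of_nonneg_left key hδs.le, mul_le_mul_of_nonneg_left hrs hc.le]

end Barrier

/-! ### Discrete solutions and the lower bound -/

section Discrete

variable {K : Geometry.SimplicialComplex ℝ (Space d)} {P : Set (Space d)} {σ h δ θ : ℝ}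
  {f w : Space d → ℝ} {𝕊 : Submodule ℝ (Space d) → Finset (Space d)}

theorem stepSize_pos_and_mem (hP : IsCompact P) (hc : Convex ℝ P) (hδ : 0 < δ) {x : Space d}
    (hx : x ∈ P) (hV : faceDir P x ≠ ⊥) : 0 < stepSize P δ x ∧
      ∀ v ∈ faceDir P x, ‖v‖ = 1 → x + stepSize P δ x • v ∈ P ∧ x - stepSize P δ x • v ∈ P := by
  have hne := faceCompl_nonempty (x₀ := x) hP.isBounded hV
  have hxx : x - x ∈ faceDir P x := by simp
  obtain ⟨r, hr, hball⟩ := exists_ball_faceDir hc hx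
  have hpos : 0 < faceDist P (faceDir P x) x x :=
    hr.trans_le (le_faceDist hne hxx fun v hv hlt => hball v hv hlt.le)
  rw [stepSize_eq hc hP.isClosed hne hx hxx rfl hpos hδ]
  have hmin := lt_min hδ hpos
  refine ⟨hmin, fun v hv hv1 => ?_⟩
  have hn : ‖min δ (faceDist P (faceDir P x) x x) • v‖ ≤ faceDist P (faceDir P x) x x := by
    rw [norm_smul, hv1, mul_one, Real.norm_of_nonneg hmin.le]
    exact min_le_right _ _
  have hmem := Submodule.smul_mem _ (min δ (faceDist P (faceDir P x) x x)) hv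
  refine ⟨add_mem_of_norm_le_faceDist hP.isClosed hx hxx hmem hn, ?_⟩
  rw [sub_eq_add_neg]
  exact add_mem_of_norm_le_faceDist hP.isClosed hx hxx (Submodule.neg_mem _ hmem)
    (by rwa [norm_neg])

theorem IsDiscreteSolution.le_obstacle (hw : IsDiscreteSolution P K δ 𝕊 f w) {x : Space d}
    (hx : x ∈ K.vertices) : w x ≤ f x := by
  by_cases hV : faceDir P x = ⊥
  · exact ((hw.2 x hx).1 hV).le
  · have h := (hw.2 x hx).2 hV
    have := min_le_left (f x - w x) (sInf ((fun v => secondDiff w (stepSize P δ x) x v) ''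
      (𝕊 (faceDir P x) : Set (Space d))))
    rw [twoScaleOp] at h
    linarith

theorem IsDiscreteSolution.second_diff_nonneg (hw : IsDiscreteSolution P K δ 𝕊 f w) {x : Space d}
    (hx : x ∈ K.vertices) (hV : faceDir P x ≠ ⊥) (hpos : 0 < stepSize P δ x) {v : Space d}
    (hv : v ∈ 𝕊 (faceDir P x)) :
    2 * w x ≤ w (x + stepSize P δ x • v) + w (x - stepSize P δ x • v) := by
  have h := (hw.2 x hx).2 hV
  have h1 := min_le_right (f x - w x) (sInf ((fun v => secondDiff w (stepSize P δ x) x v) ''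
      (𝕊 (faceDir P x) : Set (Space d))))
  rw [twoScaleOp] at h
  rw [h] at h1
  have h2 : 0 ≤ secondDiff w (stepSize P δ x) x v :=
    h1.trans (csInf_le ((𝕊 (faceDir P x)).finite_toSet.image _).bddBelow ⟨v, hv, rfl⟩)
  rw [secondDiff, le_div_iff₀ (by positivity)] at h2
  linarith

theorem IsDiscreteSolution.eq_or_second_diff_eq (hw : IsDiscreteSolution P K δ 𝕊 f w)
    {x : Space d} (hx : x ∈ K.vertices) (hpos : faceDir P x ≠ ⊥ → 0 < stepSize P δ x)
    (hne : faceDir P x ≠ ⊥ → (𝕊 (faceDir P x)).Nonempty) :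
    w x = f x ∨ faceDir P x ≠ ⊥ ∧ ∃ v ∈ 𝕊 (faceDir P x),
      2 * w x = w (x + stepSize P δ x • v) + w (x - stepSize P δ x • v) := by
  by_cases hV : faceDir P x = ⊥
  · exact Or.inl ((hw.2 x hx).1 hV)
  have h := (hw.2 x hx).2 hV
  rw [twoScaleOp] at h
  rcases min_choice (f x - w x) (sInf ((fun v => secondDiff w (stepSize P δ x) x v) ''
      (𝕊 (faceDir P x) : Set (Space d)))) with h1 | h1
  · left; linarith
  · right
    rw [h] at h1
    have hmem := (((𝕊 (faceDir P x)).finite_toSet.image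
      (fun v => secondDiff w (stepSize P δ x) x v))).isCompact.sInf_mem
        ((Finset.coe_nonempty.2 (hne hV)).image _)
    rw [← h1] at hmem
    obtain ⟨v, hv, h2⟩ := hmem
    refine ⟨hV, v, hv, ?_⟩
    have h3 := hpos hV
    dsimp only at h2
    rw [secondDiff, div_eq_zero_iff] at h2
    have := h2.resolve_right (by positivity)
    linarith

theorem convexOn_norm_sq : ConvexOn ℝ Set.univ fun z : Space d => ‖z‖ ^ 2 :=
  (convexOn_norm convex_univ).pow (fun _ _ => norm_nonneg _) 2

theorem norm_sq_add_norm_sq_sub (x v : Space d) :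
    ‖x + v‖ ^ 2 + ‖x - v‖ ^ 2 = 2 * ‖x‖ ^ 2 + 2 * ‖v‖ ^ 2 := by
  have := parallelogram_law_with_norm ℝ x v
  simp only [pow_two]
  linarith

/-- The discrete solution is above the convex envelope at the nodes. -/
theorem IsDiscreteSolution.envelope_le (hw : IsDiscreteSolution P K δ 𝕊 f w)
    (hK : IsMesh K P σ h) (hP : IsCompact P) (hc : Convex ℝ P) (hf : ContinuousOn f P)
    (hδ : 0 < δ) (hS : ∀ x ∈ K.vertices, IsSphereNet (faceDir P x) θ (𝕊 (faceDir P x)))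
    {x : Space d} (hx : x ∈ K.vertices) : convexEnvelope P f x ≤ w x := by
  set u := convexEnvelope P f
  have hu : ConvexOn ℝ P u := convexOn_convexEnvelope hP hc hf
  obtain ⟨R, hR⟩ := hP.isBounded.exists_norm_le
  have key : ∀ τ > 0, ∀ z ∈ K.vertices, u z + τ * (‖z‖ ^ 2 - R ^ 2) ≤ w z := by
    intro τ hτ
    -- The quadratic term makes φ strictly convex, and subtracting R² keeps φ ≤ u on P.
    set φ : Space d → ℝ := fun z => u z + τ * (‖z‖ ^ 2 - R ^ 2)
    have hφu : ∀ z ∈ P, φ z ≤ u z := fun z hz => by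
      have : ‖z‖ ^ 2 ≤ R ^ 2 := pow_le_pow_left₀ (norm_nonneg _) (hR z hz) 2
      simp only [φ]
      nlinarith
    have hφ : ConvexOn ℝ P φ := by
      have h1 := (convexOn_norm_sq (d := d)).subset (Set.subset_univ P) hc
      have h2 := hu.add (((h1.add_const (-(R ^ 2))).smul hτ.le))
      refine h2.congr fun z _ => ?_
      simp [φ, sub_eq_add_neg]
    obtain ⟨y, hy, hmin⟩ := Finset.exists_min_image hK.finite_vertices.toFinset
      (fun z => w z - φ z) ⟨x, by simpa using hx⟩
    rw [Set.Finite.mem_toFinset] at hy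
    have hyP := hK.vertices_subset hy
    suffices hm : 0 ≤ w y - φ y by
      intro z hz
      have := hmin z (by simpa using hz)
      simp only [φ] at this hm ⊢
      linarith
    have hge : ∀ p ∈ P, φ p + (w y - φ y) ≤ w p := by
      intro p hp
      obtain ⟨T, c, hT, hc0, hc1, hcp, -, hcw⟩ := hK.exists_combo hp
      have h1 := hφ.map_sum_le (fun z hz => (hc0 z hz).le) hc1
        fun z hz => hK.vertices_subset (hT z hz)
      rw [hcp] at h1
      rw [hcw w hw.1]
      calc φ p + (w y - φ y) ≤ ∑ z ∈ T, c z * φ z + ∑ z ∈ T, c z * (w y - φ y) := by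
            rw [← Finset.sum_mul, hc1, one_mul]
            simpa using h1
        _ = ∑ z ∈ T, c z * (φ z + (w y - φ y)) := by
            rw [← Finset.sum_add_distrib]; simp only [mul_add]
        _ ≤ ∑ z ∈ T, c z * w z := Finset.sum_le_sum fun z hz =>
            mul_le_mul_of_nonneg_left
              (by have := hmin z (by simpa using hT z hz); linarith) (hc0 z hz).le
    have hpos : faceDir P y ≠ ⊥ → 0 < stepSize P δ y := fun hV =>
      (stepSize_pos_and_mem hP hc hδ hyP hV).1
    have hSne : faceDir P y ≠ ⊥ → (𝕊 (faceDir P y)).Nonempty := fun hV => by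
      obtain ⟨v, hv, hv1⟩ := exists_unit_mem hV
      obtain ⟨v', hv', -⟩ := (hS y hy).2 v hv hv1
      exact ⟨v', hv'⟩
    rcases hw.eq_or_second_diff_eq hy hpos hSne with heq | ⟨hV, v, hv, heq⟩
    · have h1 := hφu y hyP
      have h2 : u y ≤ f y := convexEnvelope_le_self hP hf hyP
      linarith
    -- Here a second difference of w vanishes, while that of φ is at least 2τr² and w - φ is minimal
    -- at y.
    · exfalso
      obtain ⟨hr, hmem⟩ := stepSize_pos_and_mem hP hc hδ hyP hV
      set r := stepSize P δ y
      obtain ⟨hvV, hv1⟩ := (hS y hy).1 v hv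
      obtain ⟨hp, hq⟩ := hmem v hvV hv1
      have h1 := hge _ hp
      have h2 := hge _ hq
      have h3 := hu.2 hp hq (by norm_num : (0 : ℝ) ≤ 1 / 2) (by norm_num : (0 : ℝ) ≤ 1 / 2)
        (by norm_num)
      rw [show (1 / 2 : ℝ) • (y + r • v) + (1 / 2 : ℝ) • (y - r • v) = y by module] at h3
      simp only [smul_eq_mul] at h3
      have h4 := norm_sq_add_norm_sq_sub y (r • v)
      rw [norm_smul, hv1, mul_one, Real.norm_of_nonneg hr.le] at h4
      simp only [φ] at h1 h2
      have : 0 < τ * r ^ 2 := by positivity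
      nlinarith
  refine le_of_forall_pos_sub_le fun ε hε => ?_
  have h1 := key (ε / (R ^ 2 + 1)) (by positivity) x hx
  have h2 : ε / (R ^ 2 + 1) * R ^ 2 ≤ ε := by
    rw [div_mul_eq_mul_div, div_le_iff₀ (by positivity)]
    nlinarith
  have h3 : 0 ≤ ε / (R ^ 2 + 1) * ‖x‖ ^ 2 := by positivity
  linarith

end Discrete

/-! ### Contact points and directions in which the envelope is flat -/

section Flatness

variable {P : Set (Space d)} {s M : ℝ} {f u : Space d → ℝ}

/-- The function f - u is nonnegative and vanishes at z, so its value at x is bounded by its second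
difference centred at z. -/
theorem sub_le_of_near_contact (hTf : HasTaylor s M P f) (hTu : HasTaylor s M P u)
    (hle : ∀ y ∈ P, u y ≤ f y) {x z : Space d} (hz : z ∈ P) (hx : x ∈ P)
    (hrefl : z - (x - z) ∈ P) (hcontact : u z = f z) : f x - u x ≤ 4 * M * ‖x - z‖ ^ s := by
  have h := (hTf.sub hTu).second_diff_le hz (w := x - z) (by rwa [add_sub_cancel]) hrefl
  simp only [Pi.sub_apply, add_sub_cancel] at h
  have := hle _ hrefl
  linarith

/-- By convexity and `hval`, u is affine on the segment from z to q. The condition t ≤ a keeps the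
backward point between x and q. -/
theorem second_diff_flat_le (hu : ConvexOn ℝ P u) {x z q : Space d} (hx : x ∈ P) (hz : z ∈ P)
    (hq : q ∈ P) {a t : ℝ} (ha : 0 < a) (ha1 : a ≤ 1) (hxzq : x = a • z + (1 - a) • q)
    (hval : a * u z + (1 - a) * u q ≤ u x) (ht : 0 ≤ t) (hta : t ≤ a) :
    u (x + t • (z - x)) + u (x - t • (z - x)) ≤ 2 * u x := by
  set t' := t * (1 - a) / a
  have ht'0 : 0 ≤ t' := div_nonneg (mul_nonneg ht (by linarith)) ha.le
  have ht'1 : t' ≤ 1 := by rw [div_le_one ha]; nlinarith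
  have h1 := hu.2 hx hz (by linarith : 0 ≤ 1 - t) ht (by ring)
  have h2 := hu.2 hx hq (by linarith : 0 ≤ 1 - t') ht'0 (by ring)
  have e1 : (1 - t) • x + t • z = x + t • (z - x) := by module
  have e2 : (1 - t') • x + t' • q = x - t • (z - x) := by
    have e3 : (1 - a) • q = x - a • z := by rw [hxzq]; module
    have e4 : t' • q = (t / a) • ((1 - a) • q) := by
      rw [smul_smul]; congr 1; simp only [t']; ring
    have e5 : 1 - t' = 1 - t / a + t := by simp only [t']; field_simp; ring
    have e6 : (t / a) * a = t := div_mul_cancel₀ _ ha.ne'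
    rw [e4, e3, e5, smul_sub, smul_smul, e6]; module
  rw [e1] at h1
  rw [e2] at h2
  simp only [smul_eq_mul] at h1 h2
  have h3 : t * (u z - u x) + t' * (u q - u x) = (t / a) * (a * u z + (1 - a) * u q - u x) := by
    simp only [t']; field_simp; ring
  have h4 : (t / a) * (a * u z + (1 - a) * u q - u x) ≤ 0 :=
    mul_nonpos_of_nonneg_of_nonpos (by positivity) (by linarith)
  linarith

/-- Replacing p by p + w costs only ‖w‖^s, independently of ‖p‖: Taylor bounds the second
differences by w at x ± p, and convexity bounds the unwanted diagonal pair below by 2u(x). -/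
theorem second_diff_shift_le (hu : ConvexOn ℝ P u) (hTu : HasTaylor s M P u) {x p w : Space d}
    (h1 : x + p + w ∈ P) (h2 : x + p - w ∈ P) (h3 : x - p + w ∈ P)
    (h4 : x - p - w ∈ P) (hflat : u (x + p) + u (x - p) ≤ 2 * u x) :
    u (x + (p + w)) + u (x - (p + w)) - 2 * u x ≤ 4 * M * ‖w‖ ^ s := by
  have hmid : ∀ y, y + w ∈ P → y - w ∈ P → y ∈ P := fun y hy hy' => by
    have := hu.1 hy hy' (by norm_num : (0 : ℝ) ≤ 1 / 2) (by norm_num : (0 : ℝ) ≤ 1 / 2)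
      (by norm_num)
    rwa [show (1 / 2 : ℝ) • (y + w) + (1 / 2 : ℝ) • (y - w) = y by module] at this
  have e1 := hTu.second_diff_le (hmid _ h1 h2) h1 h2
  have e2 := hTu.second_diff_le (hmid _ h3 h4) h3 h4
  have e3 := hu.2 h2 h3 (by norm_num : (0 : ℝ) ≤ 1 / 2) (by norm_num : (0 : ℝ) ≤ 1 / 2)
    (by norm_num)
  rw [show (1 / 2 : ℝ) • (x + p - w) + (1 / 2 : ℝ) • (x - p + w) = x by module] at e3
  simp only [smul_eq_mul] at e3
  rw [show x + (p + w) = x + p + w by abel, show x - (p + w) = x - p - w by abel]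
  linarith

end Flatness

/-! ### The upper bound on one face -/

section Upper

variable {K : Geometry.SimplicialComplex ℝ (Space d)} {P : Set (Space d)} {σ h δ θ s M : ℝ}
  {f w u : Space d → ℝ} {𝕊 : Submodule ℝ (Space d) → Finset (Space d)}

/-- Extends the nodal bound to the stencil points, which need not be nodes. Concavity of B has the
right sign, u pays the interpolation error, and extremality keeps the interpolating nodes in the
face. -/
theorem IsMesh.le_of_nodes_le (hK : IsMesh K P σ h) (hc : Convex ℝ P)
    (hw : IsPiecewiseLinear K w) (hs : 0 ≤ s) (hM : 0 ≤ M) (hTu : HasTaylor s M P u) {x₀ : Space d}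
    (hx₀ : x₀ ∈ P) {B : Space d → ℝ}
    (hB : ConcaveOn ℝ {y | y ∈ P ∧ y - x₀ ∈ faceDir P x₀} B) {m : ℝ}
    (hm : ∀ z ∈ K.vertices, z - x₀ ∈ faceDir P x₀ → w z - u z - B z ≤ m) {y : Space d}
    (hy : y ∈ P) (hyV : y - x₀ ∈ faceDir P x₀) : w y ≤ m + B y + u y + M * h ^ s := by
  obtain ⟨T, c, hT, hc0, hc1, hcy, hTh, hcw⟩ := hK.exists_combo hy
  have hTP : ∀ z ∈ T, z ∈ P := fun z hz => hK.vertices_subset (hT z hz)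
  have hTV : ∀ z ∈ T, z - x₀ ∈ faceDir P x₀ := fun z hz => by
    obtain ⟨h1, q, hq, hsum⟩ := exists_rest_of_combo hc (fun z hz => (hc0 z hz).le) hc1 hTP hz
    exact sub_mem_faceDir_of_mem_face hc hx₀ hyV (hTP z hz) hq (hc0 z hz) h1 (hcy ▸ hsum)
  have h1 := hTu.sum_sub_le hs hM (fun z hz => (hc0 z hz).le) hc1 hy hcy hTP hTh
  have h2 := hB.le_map_sum (fun z hz => (hc0 z hz).le) hc1 fun z hz => ⟨hTP z hz, hTV z hz⟩
  rw [hcy] at h2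
  simp only [smul_eq_mul] at h2
  rw [hcw w hw]
  calc ∑ z ∈ T, c z * w z ≤ ∑ z ∈ T, c z * (m + B z + u z) := Finset.sum_le_sum fun z hz =>
        mul_le_mul_of_nonneg_left (by have := hm z (hT z hz) (hTV z hz); linarith) (hc0 z hz).le
    _ = m + ∑ z ∈ T, c z * B z + ∑ z ∈ T, c z * u z := by
        simp only [mul_add, Finset.sum_add_distrib, ← Finset.sum_mul, hc1, one_mul]
    _ ≤ _ := by linarith

set_option maxHeartbeats 1000000 in
/-- Error bound at a node, given an error bound at the nodes in the faces of smaller dimension. -/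
theorem IsDiscreteSolution.face_step (hw : IsDiscreteSolution P K δ 𝕊 f w)
    (hK : IsMesh K P σ h) (hP : IsCompact P) (hc : Convex ℝ P) (hf : ContinuousOn f P)
    (hs : 0 < s) (hM : 0 ≤ M) (hTf : HasTaylor s M P f)
    (hTu : HasTaylor s M P (convexEnvelope P f)) {R : ℝ} (hR : ∀ x ∈ P, ‖x‖ ≤ R)
    (hh : 0 < h) (hhδ : h ≤ δ) (hσ : 1 ≤ σ) (hθ1 : θ ≤ 1)
    (hS : ∀ x ∈ K.vertices, IsSphereNet (faceDir P x) θ (𝕊 (faceDir P x)))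
    {E E' : ℝ} (hE : θ * δ ≤ E * h) (hE0 : 0 ≤ E) (hE' : h ^ s ≤ E' * (δ ^ s * δ ^ 2))
    {A B₀ c : ℝ} (hA : 0 < A) (hAc : 2 * M + 2 * M * (σ ^ 2) ^ s < A * c) {g : ℝ → ℝ}
    (hg : ConcaveOn ℝ (Set.Ici 0) g) (hgm : MonotoneOn g (Set.Ici 0)) (hg0 : ∀ t, 0 ≤ t → 0 ≤ g t)
    (hgB : ∀ t, 0 ≤ t → g t ≤ B₀ * δ ^ s)
    (hgap : ∀ t, 0 < t → t ≤ 2 * (d + 2) * δ →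
      c * min δ t ^ s ≤ 2 * g t - g (t - min δ t + θ * min δ t) - g (t + min δ t))
    {A' : ℝ} (hA' : 0 < A') (hA'E : (4 * M * E ^ s + 2 * M) * E' < 2 * A')
    {x₀ : Space d} (hx₀ : x₀ ∈ K.vertices) (hV0 : faceDir P x₀ ≠ ⊥) {m₀ : ℝ}
    (hm₀ : ∀ y ∈ K.vertices, Module.finrank ℝ (faceDir P y) < Module.finrank ℝ (faceDir P x₀) →
      w y - convexEnvelope P f y ≤ m₀) :
    w x₀ - convexEnvelope P f x₀ ≤
      max m₀ (4 * M * ((d + 2) * δ) ^ s) + (A * B₀ + A' * R ^ 2) * δ ^ s := by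
  set u := convexEnvelope P f
  set V := faceDir P x₀ with hVdef
  set D := faceDist P V x₀
  have hδ : 0 < δ := hh.trans_le hhδ
  have hδs : 0 < δ ^ s := Real.rpow_pos_of_pos hδ s
  have hx₀P := hK.vertices_subset hx₀
  have hu : ConvexOn ℝ P u := convexOn_convexEnvelope hP hc hf
  have hne : (faceCompl P V x₀).Nonempty := faceCompl_nonempty hP.isBounded hV0
  have hD0 : ∀ y, 0 ≤ D y := fun y => faceDist_nonneg y
  set B : Space d → ℝ := fun y => A * g (D y) + A' * δ ^ s * (R ^ 2 - ‖y‖ ^ 2)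
  set F : Set (Space d) := {y | y ∈ P ∧ y - x₀ ∈ V}
  have hDc : ConcaveOn ℝ F D := concaveOn_faceDist hc hne
  have hB : ConcaveOn ℝ F B := by
    refine ⟨hDc.1, fun y hy z hz a b ha hb hab => ?_⟩
    have h1 := hg.2 (hD0 y) (hD0 z) ha hb hab
    have h2 := hgm (show a • D y + b • D z ∈ Set.Ici (0 : ℝ) from
      add_nonneg (mul_nonneg ha (hD0 y)) (mul_nonneg hb (hD0 z))) (hD0 _) (hDc.2 hy hz ha hb hab)
    have h3 := convexOn_norm_sq.2 (Set.mem_univ y) (Set.mem_univ z) ha hb hab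
    simp only [smul_eq_mul, B] at h1 h2 h3 ⊢
    have h4 := mul_le_mul_of_nonneg_left (h1.trans h2) hA.le
    have h5 := mul_le_mul_of_nonneg_left h3 (mul_pos hA' hδs).le
    have h6 : A' * δ ^ s * R ^ 2 = (a + b) * (A' * δ ^ s * R ^ 2) := by rw [hab, one_mul]
    linarith
  have hB0 : ∀ y ∈ P, 0 ≤ B y := fun y hy => by
    have : ‖y‖ ^ 2 ≤ R ^ 2 := pow_le_pow_left₀ (norm_nonneg _) (hR y hy) 2
    exact add_nonneg (mul_nonneg hA.le (hg0 _ (hD0 y)))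
      (mul_nonneg (mul_pos hA' hδs).le (by linarith))
  have hB1 : ∀ y, B y ≤ (A * B₀ + A' * R ^ 2) * δ ^ s := fun y => by
    have h1 := mul_le_mul_of_nonneg_left (hgB _ (hD0 y)) hA.le
    have h2 : 0 ≤ A' * δ ^ s * ‖y‖ ^ 2 := by positivity
    simp only [B]; linarith
  have hfin : {z | z ∈ K.vertices ∧ z - x₀ ∈ V}.Finite :=
    hK.finite_vertices.subset fun z hz => hz.1
  obtain ⟨x, hxmem, hmax⟩ := Finset.exists_max_image hfin.toFinset
    (fun z => w z - u z - B z) ⟨x₀, by simp [hx₀]⟩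
  rw [Set.Finite.mem_toFinset] at hxmem
  obtain ⟨hx, hxV⟩ := hxmem
  have hxP := hK.vertices_subset hx
  set m := w x - u x - B x
  have hmax' : ∀ z ∈ K.vertices, z - x₀ ∈ V → w z - u z - B z ≤ m := fun z hz hzV =>
    hmax z (by simpa using ⟨hz, hzV⟩)
  suffices hm : m ≤ max m₀ (4 * M * ((d + 2) * δ) ^ s) by
    have h1 := hmax' x₀ hx₀ (by simp)
    have h2 := hB1 x₀
    linarith
  rcases (hD0 x).eq_or_lt with ht0 | ht
  · have h1 := hm₀ x hx (finrank_faceDir_lt hc hne hx₀P hxP hxV ht0.symm)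
    have h2 := hB0 x hxP
    exact le_trans (by simp only [m]; linarith) (le_max_left _ _)
  have hVx : faceDir P x = V := faceDir_eq_of_faceDist_pos hc hx₀P hxV ht
  have hstep : stepSize P δ x = min δ (D x) := stepSize_eq hc hP.isClosed hne hxP hxV hVx ht hδ
  have hVx0 : faceDir P x ≠ ⊥ := hVx ▸ hV0
  obtain ⟨hr, hrmem⟩ := stepSize_pos_and_mem hP hc hδ hxP hVx0
  have hnet := hS x hx
  have hsecond := fun v hv => hw.second_diff_nonneg hx hVx0 hr (v := v) hv
  rw [hVx] at hrmem hnet hsecond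
  rw [hstep] at hr hrmem hsecond
  set r := min δ (D x)
  have hrδ : r ≤ δ := min_le_left _ _
  have hrD : r ≤ D x := min_le_right _ _
  have hmemF : ∀ v ∈ V, x + v - x₀ ∈ V ∧ x - v - x₀ ∈ V := fun v hv =>
    ⟨by rw [add_sub_right_comm]; exact V.add_mem hxV hv,
      by rw [sub_right_comm]; exact V.sub_mem hxV hv⟩
  -- The discrete maximum principle: w has nonnegative second difference at x, and each of the two
  -- stencil points costs M h^s.
  have test : ∀ v ∈ 𝕊 V, 2 * B x - B (x + r • v) - B (x - r • v) ≤
      u (x + r • v) + u (x - r • v) - 2 * u x + 2 * (M * h ^ s) := by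
    intro v hv
    obtain ⟨hvV, hv1⟩ := hnet.1 v hv
    obtain ⟨h1, h2⟩ := hrmem v hvV hv1
    obtain ⟨h3, h4⟩ := hmemF _ (V.smul_mem r hvV)
    have h5 := hK.le_of_nodes_le hc hw.1 hs.le hM hTu hx₀P hB hmax' h1 h3
    have h6 := hK.le_of_nodes_le hc hw.1 hs.le hM hTu hx₀P hB hmax' h2 h4
    have h7 := hsecond v hv
    have h8 : m = w x - u x - B x := rfl
    linarith
  have quad : ∀ v ∈ 𝕊 V, 2 * B x - B (x + r • v) - B (x - r • v) =
      A * (2 * g (D x) - g (D (x + r • v)) - g (D (x - r • v))) + 2 * (A' * δ ^ s * r ^ 2) := by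
    intro v hv
    have h1 := norm_sq_add_norm_sq_sub x (r • v)
    rw [norm_smul, (hnet.1 v hv).2, mul_one, Real.norm_of_nonneg hr.le] at h1
    have h2 : ‖x + r • v‖ ^ 2 = 2 * ‖x‖ ^ 2 + 2 * r ^ 2 - ‖x - r • v‖ ^ 2 := by linarith
    simp only [B, h2]
    ring
  -- The width 2(d+2)δ leaves room, outside the layer, to reflect x across a contact point at
  -- distance up to (d+2)δ.
  by_cases hlayer : D x ≤ 2 * (d + 2) * δ
  · exfalso
    obtain ⟨n, hnV, hn, hnP, hn0⟩ := exists_closest hP.isClosed hne hxP hxV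
    have hn' : ‖n‖ = D x := hn
    have hunit : ‖(D x)⁻¹ • n‖ = 1 := by
      rw [norm_smul, norm_inv, Real.norm_of_nonneg ht.le, hn', inv_mul_cancel₀ ht.ne']
    obtain ⟨v, hv, hvn⟩ := hnet.2 _ (V.smul_mem _ hnV) hunit
    obtain ⟨hvV, hv1⟩ := hnet.1 v hv
    obtain ⟨hp, hq⟩ := hrmem v hvV hv1
    -- The direction v is within θ of the unit direction towards the closest boundary point, so a
    -- step r reduces the distance by at least r - θr.
    have hDp : D (x + r • v) ≤ D x - r + θ * r := by
      have h1 := faceDist_le_add_norm (P := P) (V := V) (x₀ := x₀) (x + r • v) (x + n)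
      rw [hn0, zero_add, add_sub_add_left_eq_sub] at h1
      have h2 : r • v - n = r • (v - (D x)⁻¹ • n) - ((D x - r) * (D x)⁻¹) • n := by
        have : n = (D x * (D x)⁻¹) • n := by rw [mul_inv_cancel₀ ht.ne', one_smul]
        rw [sub_mul, sub_smul, ← this, smul_sub, smul_smul]; abel
      have h3 : ‖r • v - n‖ ≤ r * θ + (D x - r) := by
        rw [h2]
        refine (norm_sub_le _ _).trans (add_le_add ?_ ?_)
        · rw [norm_smul, Real.norm_of_nonneg hr.le, norm_sub_rev]
          exact mul_le_mul_of_nonneg_left hvn hr.le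
        · rw [mul_smul, norm_smul, hunit, mul_one, Real.norm_of_nonneg (by linarith)]
      linarith
    have hDq : D (x - r • v) ≤ D x + r := by
      have h1 := faceDist_le_add_norm (P := P) (V := V) (x₀ := x₀) (x - r • v) x
      rw [sub_sub_cancel_left, norm_neg, norm_smul, hv1, mul_one, Real.norm_of_nonneg hr.le] at h1
      exact h1
    have h1 := test v hv
    rw [quad v hv] at h1
    have h2 := hgap (D x) ht hlayer
    have h3 := hgm (hD0 (x + r • v)) (show D x - r + θ * r ∈ Set.Ici (0 : ℝ) from
      (hD0 _).trans hDp) hDp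
    have h4 := hgm (hD0 (x - r • v)) (show D x + r ∈ Set.Ici (0 : ℝ) from
      (hD0 _).trans hDq) hDq
    have h5 := hTu.second_diff_le hxP hp hq
    rw [norm_smul, hv1, mul_one, Real.norm_of_nonneg hr.le] at h5
    have hσ2 : 1 ≤ σ ^ 2 := one_le_pow₀ hσ
    have hhr : h ≤ σ ^ 2 * r := by
      have h6 := hK.le_faceDist hP.isClosed hc hh (by linarith) hne hx hxV ht
      rw [div_le_iff₀ (by positivity), mul_comm] at h6
      rcases min_choice δ (D x) with h7 | h7
      · have : r = δ := h7
        rw [this]; nlinarith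
      · have : r = D x := h7
        rw [this]; exact h6
    have hhs : h ^ s ≤ (σ ^ 2) ^ s * r ^ s := by
      rw [← Real.mul_rpow (by positivity) hr.le]
      exact Real.rpow_le_rpow hh.le hhr hs.le
    have hrs : 0 < r ^ s := Real.rpow_pos_of_pos hr s
    have h7 : A * (c * r ^ s) ≤ A * (2 * g (D x) - g (D (x + r • v)) - g (D (x - r • v))) :=
      mul_le_mul_of_nonneg_left (by linarith) hA.le
    have h8 : 0 ≤ A' * δ ^ s * r ^ 2 := by positivity
    have h9 := mul_le_mul_of_nonneg_left hhs hM
    have h10 := mul_lt_mul_of_pos_right hAc hrs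
    linarith
  · rw [not_le] at hlayer
    have hd2 : (2 : ℝ) ≤ d + 2 := by linarith [(Nat.cast_nonneg d : (0 : ℝ) ≤ d)]
    have hrδ' : r = δ := min_eq_left (by nlinarith)
    have hball : ∀ v ∈ V, ‖v‖ ≤ 2 * (d + 2) * δ → x + v ∈ P := fun v hv hvn =>
      add_mem_of_norm_lt_faceDist hxV hv (hvn.trans_lt hlayer)
    obtain ⟨z, hz, q, hq, a, ha, ha1, hxzq, hcontact, hval⟩ := exists_contact_segment hP hc hf hxP
    have ha0 : 0 < a := lt_of_lt_of_le (by positivity) ha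
    have hzV : z - x ∈ V := hVx ▸ sub_mem_faceDir_of_combo hc hz hq ha0 ha1 hxzq
    by_cases hnear : ‖x - z‖ ≤ (d + 2) * δ
    · have hrefl : z - (x - z) ∈ P := by
        have h1 := hball ((2 : ℝ) • (z - x)) (V.smul_mem _ hzV) (by
          rw [norm_smul, norm_sub_rev, Real.norm_of_nonneg (by norm_num)]; linarith)
        rwa [show x + (2 : ℝ) • (z - x) = z - (x - z) by module] at h1
      have h1 := sub_le_of_near_contact hTf hTu (fun y hy => convexEnvelope_le_self hP hf hy)
        hz hxP hrefl hcontact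
      have h2 : ‖x - z‖ ^ s ≤ ((d + 2) * δ) ^ s := Real.rpow_le_rpow (norm_nonneg _) hnear hs.le
      have h3 := mul_le_mul_of_nonneg_left h2 (by linarith : 0 ≤ 4 * M)
      have h4 := hw.le_obstacle hx
      have h5 := hB0 x hxP
      exact le_trans (by simp only [m]; linarith) (le_max_right _ _)
    · exfalso
      rw [not_le, norm_sub_rev] at hnear
      have hzx : 0 < ‖z - x‖ := lt_of_le_of_lt (by positivity) hnear
      set t := δ / ‖z - x‖
      -- Since z is farther than (d+2)δ, a displacement of length δ towards z is at most the
      -- fraction 1/(d+2) of the way.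
      have hta : t ≤ a := by
        refine le_trans ?_ ha
        rw [div_le_div_iff₀ hzx (by positivity)]
        linarith
      have hflat := second_diff_flat_le hu hxP hz hq ha0 ha1 hxzq hval
        (by positivity : 0 ≤ t) hta
      have hpV : t • (z - x) ∈ V := V.smul_mem _ hzV
      have hpn : ‖t • (z - x)‖ = δ := by
        rw [norm_smul, Real.norm_of_nonneg (by positivity), div_mul_cancel₀ _ hzx.ne']
      set p := t • (z - x)
      have hunit : ‖δ⁻¹ • p‖ = 1 := by
        rw [norm_smul, norm_inv, Real.norm_of_nonneg hδ.le, hpn, inv_mul_cancel₀ hδ.ne']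
      obtain ⟨v, hv, hvn⟩ := hnet.2 _ (V.smul_mem _ hpV) hunit
      obtain ⟨hvV, hv1⟩ := hnet.1 v hv
      set e := δ • v - p
      have heV : e ∈ V := V.sub_mem (V.smul_mem _ hvV) hpV
      have hen : ‖e‖ ≤ θ * δ := by
        have : e = δ • (v - δ⁻¹ • p) := by
          rw [smul_sub, smul_smul, mul_inv_cancel₀ hδ.ne', one_smul]
        rw [this, norm_smul, norm_sub_rev, Real.norm_of_nonneg hδ.le, mul_comm]
        exact mul_le_mul_of_nonneg_right hvn hδ.le
      have hen2 : ‖e‖ ≤ δ := hen.trans (mul_le_of_le_one_left hδ.le hθ1)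
      have hin : ∀ y ∈ V, ‖y‖ ≤ δ → ∀ y' ∈ V, ‖y'‖ ≤ δ → x + (y + y') ∈ P :=
        fun y hy hyn y' hy' hyn' => hball _ (V.add_mem hy hy')
          ((norm_add_le y y').trans ((add_le_add hyn hyn').trans (by
            rw [← two_mul]; exact mul_le_mul_of_nonneg_right (by linarith) hδ.le)))
      have hshift := second_diff_shift_le hu hTu (x := x) (p := p) (w := e)
        (by simpa [add_assoc] using hin p hpV hpn.le e heV hen2)
        (by simpa [sub_eq_add_neg, add_assoc] using
          hin p hpV hpn.le (-e) (V.neg_mem heV) (by rwa [norm_neg]))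
        (by simpa [sub_eq_add_neg, add_assoc] using
          hin (-p) (V.neg_mem hpV) (by rw [norm_neg, hpn]) e heV hen2)
        (by simpa [sub_eq_add_neg, add_assoc] using
          hin (-p) (V.neg_mem hpV) (by rw [norm_neg, hpn]) (-e) (V.neg_mem heV)
              (by rwa [norm_neg])) hflat
      rw [show p + e = δ • v by simp [e]] at hshift
      have h1 := test v hv
      rw [quad v hv] at h1
      obtain ⟨hp', hq'⟩ := hrmem v hvV hv1
      obtain ⟨hpV', hqV'⟩ := hmemF _ (V.smul_mem r hvV)
      have hgmid : g (D (x + r • v)) + g (D (x - r • v)) ≤ 2 * g (D x) := by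
        have h2 := hg.2 (hD0 (x + r • v)) (hD0 (x - r • v)) (by norm_num : (0 : ℝ) ≤ 1 / 2)
          (by norm_num : (0 : ℝ) ≤ 1 / 2) (by norm_num)
        have h3 := hDc.2 (x := x + r • v) ⟨hp', hpV'⟩ (y := x - r • v) ⟨hq', hqV'⟩
          (by norm_num : (0 : ℝ) ≤ 1 / 2) (by norm_num : (0 : ℝ) ≤ 1 / 2) (by norm_num)
        rw [show (1 / 2 : ℝ) • (x + r • v) + (1 / 2 : ℝ) • (x - r • v) = x by module] at h3
        have h4 := hgm (show (1 / 2 : ℝ) • D (x + r • v) + (1 / 2 : ℝ) • D (x - r • v) ∈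
          Set.Ici (0 : ℝ) from add_nonneg (mul_nonneg (by norm_num) (hD0 _))
            (mul_nonneg (by norm_num) (hD0 _))) (hD0 x) h3
        simp only [smul_eq_mul] at h2 h4
        linarith
      have h2 : 0 ≤ A * (2 * g (D x) - g (D (x + r • v)) - g (D (x - r • v))) :=
        mul_nonneg hA.le (by linarith)
      rw [hrδ'] at h1 h2
      have h3 : ‖e‖ ^ s ≤ E ^ s * h ^ s := by
        rw [← Real.mul_rpow hE0 hh.le]
        exact Real.rpow_le_rpow (norm_nonneg _) (hen.trans hE) hs.le
      have h4 := mul_le_mul_of_nonneg_left h3 (by linarith : 0 ≤ 4 * M)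
      have h5 : (4 * M * E ^ s + 2 * M) * h ^ s ≤
          (4 * M * E ^ s + 2 * M) * (E' * (δ ^ s * δ ^ 2)) :=
        mul_le_mul_of_nonneg_left hE' (by positivity)
      have h6 := mul_lt_mul_of_pos_right hA'E (by positivity : 0 < δ ^ s * δ ^ 2)
      linarith

end Upper

/-! ### Choice of constants and the rate -/

section Rate

variable {K : Geometry.SimplicialComplex ℝ (Space d)} {P : Set (Space d)} {σ h : ℝ}
  {f u w : Space d → ℝ}

/-- The contact segment through x is parallel to a trivial face, so its contact point is x. This
starts the induction on faces. -/
theorem convexEnvelope_eq_of_vertex (hP : IsCompact P) (hc : Convex ℝ P) (hf : ContinuousOn f P)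
    {x : Space d} (hx : x ∈ P) (hV : faceDir P x = ⊥) : convexEnvelope P f x = f x := by
  obtain ⟨z, hz, q, hq, a, ha, ha1, hxzq, hcontact, -⟩ := exists_contact_segment hP hc hf hx
  have ha0 : 0 < a := lt_of_lt_of_le (by positivity) ha
  have h := sub_mem_faceDir_of_combo hc hz hq ha0 ha1 hxzq
  rw [hV, Submodule.mem_bot, sub_eq_zero] at h
  exact h ▸ hcontact

theorem IsMesh.mono_const (hK : IsMesh K P σ h) {σ' : ℝ} (hσ : σ ≤ σ') : IsMesh K P σ' h where
  finite := hK.finite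
  pure := hK.pure
  space_eq := hK.space_eq
  diam_le := hK.diam_le
  shape_regular T hT := by
    obtain ⟨c, r, hr, hball, hd⟩ := hK.shape_regular T hT
    exact ⟨c, r, hr, hball, hd.trans (mul_le_mul_of_nonneg_right hσ (by positivity))⟩
  quasi_uniform T hT :=
    (hK.quasi_uniform T hT).trans (mul_le_mul_of_nonneg_right hσ Metric.diam_nonneg)

/-- Bounds of the error at the nodes give bounds everywhere. -/
theorem IsMesh.abs_sub_le (hK : IsMesh K P σ h) {s M : ℝ} (hs : 0 ≤ s) (hM : 0 ≤ M)
    (hu : ConvexOn ℝ P u) (hTu : HasTaylor s M P u) (hw : IsPiecewiseLinear K w)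
    (hlow : ∀ z ∈ K.vertices, u z ≤ w z) {m : ℝ} (hup : ∀ z ∈ K.vertices, w z - u z ≤ m)
    {x : Space d} (hx : x ∈ P) : |u x - w x| ≤ m + M * h ^ s := by
  obtain ⟨T, c, hT, hc0, hc1, hcx, hTh, hcw⟩ := hK.exists_combo hx
  have hTP : ∀ z ∈ T, z ∈ P := fun z hz => hK.vertices_subset (hT z hz)
  have h1 := hTu.sum_sub_le hs hM (fun z hz => (hc0 z hz).le) hc1 hx hcx hTP hTh
  have h2 := hu.map_sum_le (fun z hz => (hc0 z hz).le) hc1 hTP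
  rw [hcx] at h2
  simp only [smul_eq_mul] at h2
  have h3 : ∑ z ∈ T, c z * u z ≤ ∑ z ∈ T, c z * w z := Finset.sum_le_sum fun z hz =>
    mul_le_mul_of_nonneg_left (hlow z (hT z hz)) (hc0 z hz).le
  have h4 : ∑ z ∈ T, c z * w z ≤ m + ∑ z ∈ T, c z * u z := by
    calc ∑ z ∈ T, c z * w z ≤ ∑ z ∈ T, c z * (m + u z) := Finset.sum_le_sum fun z hz =>
          mul_le_mul_of_nonneg_left (by have := hup z (hT z hz); linarith) (hc0 z hz).le
      _ = _ := by simp only [mul_add, Finset.sum_add_distrib, ← Finset.sum_mul, hc1, one_mul]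
  rw [← hcw w hw] at h3 h4
  rw [abs_le]
  constructor <;> linarith

theorem exists_nodal_bound {s M σ c₁ c₂ : ℝ} (hs : 0 < s) (hs2 : s ≤ 2) (hM : 0 ≤ M)
    (hσ : 1 ≤ σ) (hc₁ : 0 < c₁) (hP : IsCompact P) (hc : Convex ℝ P) :
    ∃ C ≥ 0, ∀ f : Space d → ℝ, ContinuousOn f P → HasTaylor s M P f →
      HasTaylor s M P (convexEnvelope P f) → ∀ h δ θ : ℝ, 0 < h → h ≤ δ → 0 < θ → θ ≤ 1 →
      c₁ * h ^ (s / (2 + s)) ≤ δ → δ ≤ c₂ * h ^ (s / (2 + s)) → θ ≤ c₂ * h ^ (2 / (2 + s)) →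
      ∀ K : Geometry.SimplicialComplex ℝ (Space d), IsMesh K P σ h →
      ∀ 𝕊 : Submodule ℝ (Space d) → Finset (Space d),
        (∀ x ∈ K.vertices, IsSphereNet (faceDir P x) θ (𝕊 (faceDir P x))) →
      ∀ w, IsDiscreteSolution P K δ 𝕊 f w →
      ∀ x ∈ K.vertices, w x - convexEnvelope P f x ≤ C * δ ^ s := by
  obtain ⟨R, hR0, hR⟩ : ∃ R ≥ 0, ∀ x ∈ P, ‖x‖ ≤ R := by
    obtain ⟨R, hR⟩ := hP.isBounded.exists_norm_le
    exact ⟨|R|, abs_nonneg R, fun x hx => (hR x hx).trans (le_abs_self R)⟩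
  have hN : (1 : ℝ) ≤ 2 * (d + 2) := by linarith [(Nat.cast_nonneg d : (0 : ℝ) ≤ d)]
  obtain ⟨B₀, hB₀, c, hc0, θ₀, hθ₀, hθ₀1, hbar⟩ := exists_barrier hs hs2 hN
  set Eσ := 2 * M + 2 * M * (σ ^ 2) ^ s
  have hEσ : 0 ≤ Eσ := by positivity
  set A := (Eσ + 1) / c
  have hA : 0 < A := by positivity
  have hAc : Eσ < A * c := by simp only [A]; rw [div_mul_cancel₀ _ hc0.ne']; linarith
  -- E comes from multiplying the upper bounds for θ and δ; E' comes from raising the lower bound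
  -- for δ to the power s + 2.
  set E := c₂ ^ 2
  set E' := (c₁ ^ (s + 2))⁻¹
  have hE' : 0 < E' := by positivity
  set A' := (4 * M * E ^ s + 2 * M) * E' + 1
  have hX : 0 ≤ (4 * M * E ^ s + 2 * M) * E' := by positivity
  have hA' : 0 < A' := by positivity
  set C₀ := 4 * M * (d + 2) ^ s + (A * B₀ + A' * R ^ 2)
  have hC₀ : 0 ≤ C₀ := by positivity
  -- If θ > θ₀, the upper bound for θ keeps h away from 0, and the lower bound for δ then gives δ ≥
  -- δ₀. The barrier is unavailable, but w - u ≤ f - u ≤ M(2R)^s suffices.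
  set δ₀ := c₁ * (θ₀ / |c₂|) ^ (s / 2)
  refine ⟨d * C₀ + M * (2 * R) ^ s / δ₀ ^ s, by positivity, ?_⟩
  intro f hf hTf hTu h δ θ hh hhδ hθ hθ1 hδ1 hδ2 hθ2 K hK 𝕊 hS w hw
  have hδ : 0 < δ := hh.trans_le hhδ
  have hδs : 0 < δ ^ s := Real.rpow_pos_of_pos hδ s
  have hc₂ : 0 < c₂ := by
    by_contra hneg
    have := mul_nonpos_of_nonpos_of_nonneg (not_lt.1 hneg)
      (Real.rpow_nonneg hh.le (2 / (2 + s)))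
    linarith
  have h2s : 0 < 2 + s := by positivity
  rcases le_or_gt θ θ₀ with hsmall | hlarge
  · obtain ⟨g, hg, hgm, hg0, hgB, hgap⟩ := hbar δ hδ
    have hEθ : θ * δ ≤ E * h := by
      calc θ * δ ≤ (c₂ * h ^ (2 / (2 + s))) * (c₂ * h ^ (s / (2 + s))) := by gcongr
        _ = E * (h ^ (2 / (2 + s)) * h ^ (s / (2 + s))) := by simp only [E]; ring
        _ = E * h := by
          rw [← Real.rpow_add hh, ← add_div, div_self h2s.ne', Real.rpow_one]
    have hE's : h ^ s ≤ E' * (δ ^ s * δ ^ 2) := by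
      have h1 : (c₁ * h ^ (s / (2 + s))) ^ (s + 2) ≤ δ ^ (s + 2) :=
        Real.rpow_le_rpow (by positivity) hδ1 (by positivity)
      rw [Real.mul_rpow hc₁.le (by positivity), ← Real.rpow_mul hh.le, add_comm s 2,
        div_mul_cancel₀ _ h2s.ne', add_comm 2 s, Real.rpow_add hδ, Real.rpow_two] at h1
      simp only [E']
      rw [le_inv_mul_iff₀ (by positivity)]
      exact h1
    -- Each face dimension adds the same amount C₀ δ^s, so at most d C₀ δ^s accumulates.
    have hind : ∀ n : ℕ, ∀ x ∈ K.vertices, Module.finrank ℝ (faceDir P x) = n →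
        w x - convexEnvelope P f x ≤ n * C₀ * δ ^ s := by
      intro n
      induction n using Nat.strong_induction_on with
      | _ n ih =>
        intro x hx hn
        have hxP := hK.vertices_subset hx
        by_cases hV : faceDir P x = ⊥
        · rw [convexEnvelope_eq_of_vertex hP hc hf hxP hV, (hw.2 x hx).1 hV, sub_self]
          positivity
        · have hn1 : 1 ≤ n := by
            rw [← hn, Nat.one_le_iff_ne_zero]
            simpa [Submodule.finrank_eq_zero] using hV
          have hstep := hw.face_step hK hP hc hf hs hM hTf hTu hR hh hhδ hσ hθ1 hS hEθ
            (by positivity) hE's hA hAc hg hgm hg0 hgB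
            (fun t ht htN => hgap t ht htN θ hθ.le hsmall) hA' (by simp only [A']; linarith)
            hx hV (m₀ := (n - 1) * C₀ * δ ^ s) fun y hy hlt => by
              rw [hn] at hlt
              refine (ih _ hlt y hy rfl).trans ?_
              have : (Module.finrank ℝ (faceDir P y) : ℝ) ≤ n - 1 := by
                rw [le_sub_iff_add_le]; exact_mod_cast hlt
              gcongr
          have hn1' : (1 : ℝ) ≤ n := by exact_mod_cast hn1
          have h0 : 0 ≤ (n - 1) * C₀ * δ ^ s :=
            mul_nonneg (mul_nonneg (by linarith) hC₀) hδs.le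
          have h1 : 4 * M * ((d + 2) * δ) ^ s = 4 * M * (d + 2) ^ s * δ ^ s := by
            rw [Real.mul_rpow (by positivity) hδ.le]; ring
          have h2 : 0 ≤ 4 * M * ((d + 2) * δ) ^ s := by positivity
          have h3 := max_le_add_of_nonneg h0 h2
          have h4 : (n : ℝ) * C₀ * δ ^ s = (n - 1) * C₀ * δ ^ s + (4 * M * (d + 2) ^ s * δ ^ s +
              (A * B₀ + A' * R ^ 2) * δ ^ s) := by simp only [C₀]; ring
          linarith
    intro x hx
    refine (hind _ x hx rfl).trans (mul_le_mul_of_nonneg_right ?_ hδs.le)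
    have h1 : (Module.finrank ℝ (faceDir P x) : ℝ) ≤ d := by
      exact_mod_cast (Submodule.finrank_le _).trans (by simp)
    have h2 := mul_le_mul_of_nonneg_right h1 hC₀
    have h3 : 0 ≤ M * (2 * R) ^ s / δ₀ ^ s := by positivity
    linarith
  · intro x hx
    have hxP := hK.vertices_subset hx
    have h1 := sub_convexEnvelope_le hs.le hM hTf (R := 2 * R) (fun y hy z hz =>
      (norm_sub_le _ _).trans (by linarith [hR y hy, hR z hz])) hxP
    have h2 := hw.le_obstacle hx
    have hδ₀ : 0 < δ₀ := by positivity
    have hδ₀δ : δ₀ ≤ δ := by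
      refine le_trans (mul_le_mul_of_nonneg_left ?_ hc₁.le) hδ1
      have h3 : θ₀ / |c₂| ≤ h ^ (2 / (2 + s)) := by
        rw [abs_of_pos hc₂, div_le_iff₀ hc₂, mul_comm]; linarith
      have h4 := Real.rpow_le_rpow (by positivity) h3 (by positivity : 0 ≤ s / 2)
      rwa [← Real.rpow_mul hh.le, show 2 / (2 + s) * (s / 2) = s / (2 + s) by field_simp] at h4
    have h3 : δ₀ ^ s ≤ δ ^ s := Real.rpow_le_rpow hδ₀.le hδ₀δ hs.le
    have h4 : M * (2 * R) ^ s ≤ M * (2 * R) ^ s / δ₀ ^ s * δ ^ s := by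
      rw [div_mul_eq_mul_div, le_div_iff₀ (by positivity)]
      exact mul_le_mul_of_nonneg_left h3 (by positivity)
    have h5 : 0 ≤ d * C₀ * δ ^ s := by positivity
    linarith

end Rate

end TwoScale

theorem proposition3p7 (d : ℕ) (N : Finset (TwoScale.Space d)) (P : Set (TwoScale.Space d))
    (hP : P = convexHull ℝ (N : Set (TwoScale.Space d))) (hne : (interior P).Nonempty)
    (k : ℕ) (hk : k = 0 ∨ k = 1) (α : ℝ) (hα : 0 < α) (hα' : α ≤ 1)
    (σ M c₁ c₂ : ℝ) (hc₁ : 0 < c₁) :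
    ∃ C : ℝ, ∀ f : TwoScale.Space d → ℝ,
      TwoScale.IsHolder k α M P f →
      TwoScale.IsHolder k α M P (TwoScale.convexEnvelope P f) →
      ∀ (h δ θ : ℝ), 0 < h → h ≤ δ → 0 < θ → θ ≤ 1 →
        c₁ * h ^ ((k + α) / (2 + k + α)) ≤ δ → δ ≤ c₂ * h ^ ((k + α) / (2 + k + α)) →
        θ ≤ c₂ * h ^ (2 / (2 + k + α)) →
      ∀ K : Geometry.SimplicialComplex ℝ (TwoScale.Space d), TwoScale.IsMesh K P σ h →
      ∀ 𝕊 : Submodule ℝ (TwoScale.Space d) → Finset (TwoScale.Space d),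
        (∀ x ∈ K.vertices,
          TwoScale.IsSphereNet (TwoScale.faceDir P x) θ (𝕊 (TwoScale.faceDir P x))) →
      ∀ uε : TwoScale.Space d → ℝ, TwoScale.IsDiscreteSolution P K δ 𝕊 f uε →
        ∀ x ∈ P, |TwoScale.convexEnvelope P f x - uε x| ≤
          C * h ^ ((k + α) ^ 2 / (2 + k + α)) := by
  have hPc : IsCompact P := hP ▸ N.finite_toSet.isCompact_convexHull ℝ
  have hconv : Convex ℝ P := hP ▸ convex_convexHull ℝ _
  have hk0 : (0 : ℝ) ≤ k := Nat.cast_nonneg k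
  have hk1 : (k : ℝ) ≤ 1 := by rcases hk with rfl | rfl <;> simp
  simp only [add_assoc (2 : ℝ)]
  set s : ℝ := k + α with hs_def
  have hs : 0 < s := by positivity
  have hs2 : s ≤ 2 := by simp only [hs_def]; linarith
  -- The mesh constant is enlarged to be at least 1, as the layer estimate h ≤ σ² r needs when r =
  -- δ.
  have hσ : 1 ≤ |σ| + 1 := by linarith [abs_nonneg σ]
  obtain ⟨C, hC, hbound⟩ :=
    TwoScale.exists_nodal_bound (c₂ := c₂) hs hs2 (abs_nonneg M) hσ hc₁ hPc hconv
  refine ⟨(C + |M|) * c₂ ^ s, ?_⟩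
  intro f hf hu h δ θ hh hhδ hθ hθ1 hδ1 hδ2 hθ2 K hK 𝕊 hS w hw x hx
  have hK' := hK.mono_const (show σ ≤ |σ| + 1 by linarith [le_abs_self σ])
  have hδ : 0 < δ := hh.trans_le hhδ
  have hfc : ContinuousOn f P := hf.1.continuousOn
  have hTf := hf.hasTaylor hk hα hconv hne
  have hTu := hu.hasTaylor hk hα hconv hne
  have hup := hbound f hfc hTf hTu h δ θ hh hhδ hθ hθ1 hδ1 hδ2 hθ2 K hK' 𝕊 hS w hw
  have h1 := hK.abs_sub_le hs.le (abs_nonneg M) (TwoScale.convexOn_convexEnvelope hPc hconv hfc) hTu hw.1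
    (fun z hz => hw.envelope_le hK hPc hconv hfc hδ hS hz) hup hx
  have hc₂ : 0 ≤ c₂ := by
    by_contra hneg
    have := mul_nonpos_of_nonpos_of_nonneg (not_le.1 hneg).le
      (Real.rpow_nonneg hh.le (s / (2 + s)))
    linarith
  have h2 : h ^ s ≤ δ ^ s := Real.rpow_le_rpow hh.le hhδ hs.le
  have h3 : δ ^ s ≤ c₂ ^ s * h ^ (s ^ 2 / (2 + s)) := by
    calc δ ^ s ≤ (c₂ * h ^ (s / (2 + s))) ^ s := Real.rpow_le_rpow hδ.le hδ2 hs.le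
      _ = c₂ ^ s * h ^ (s ^ 2 / (2 + s)) := by
        rw [Real.mul_rpow hc₂ (by positivity), ← Real.rpow_mul hh.le]
        congr 2; ring
  calc |TwoScale.convexEnvelope P f x - w x| ≤ C * δ ^ s + |M| * h ^ s := h1
    _ ≤ C * δ ^ s + |M| * δ ^ s := by gcongr
    _ = (C + |M|) * δ ^ s := by ring
    _ ≤ (C + |M|) * (c₂ ^ s * h ^ (s ^ 2 / (2 + s))) := by gcongr
    _ = _ := by ring
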